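/- **Theorem.** Let $X$ be a complex Banach space, let $\mathfrak{p}_1<\mathfrak{p}_2<\dots$ be the sequence of prime numbers, and for a multi-index $\alpha\in\mathbb{N}_0^{(\mathbb{N})}$ (a finitely supported sequence in $\mathbb{N}_0$) write $\mathfrak{p}^\alpha=\prod_k\mathfrak{p}_k^{\alpha_k}$. *Holomorphic functions.* Let $B_{c_0}$ be the open unit ball of the space $c_0$ of complex null sequences (with the sup norm), and let $H_\infty(B_{c_0},X)$ be the space of bounded holomorphic functions $F:B_{c_0}\to X$ with the supremum norm. Every such $F$ has a unique monomial expansion $F\equiv\sum_\alpha c_\alpha(F)z^\alpha$, characterized by $F(z_1,\dots,z_m,0,0,\dots)=\sum_{\alpha\in\mathbb{N}_0^m}c_\alpha(F)z^\alpha$ for all $m$ and all $(z_1,\dots,z_m)\in\mathbb{D}^m$. *Dirichlet series.* A Dirichlet series $D=\sum_n a_nn^{-s}$ in $X$ is identified with its sequence of coefficients $(a_n)_{n\ge1}$ in $X$. Let $H_\infty(\mathbb{T}^{\mathbb{N}},X)$ be the space of (classes of) essentially bounded strongly measurable $f:\mathbb{T}^{\mathbb{N}}\to X$ on the infinite torus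 with normalized Haar measure such that $\hat f(\alpha)=\int f(\omega)\omega^{-\alpha}\,d\omega=0$ for every finitely supported integer sequence $\alpha$ with a negative entry, with the essential supremum norm. Let $\mathcal{H}_\infty(X)$ be the space of Dirichlet series $\sum_n a_nn^{-s}$ for which there is a (necessarily unique) $f\in H_\infty(\mathbb{T}^{\mathbb{N}},X)$ with $a_{\mathfrak{p}^\alpha}=\hat f(\alpha)$ for all $\alpha\in\mathbb{N}_0^{(\mathbb{N})}$, normed by $\|f\|_\infty$. For $\varepsilon>0$ put $D_\varepsilon=\sum_n\frac{a_n}{n^\varepsilon}n^{-s}$, and let $\mathcal{H}_\infty^+(X)$ be the space of Dirichlet series $D$ in $X$ such that $D_\varepsilon\in\mathcal{H}_\infty(X)$ for every $\varepsilon>0$ and $$\|D\|_{\mathcal{H}_\infty^+(X)}:=\sup_{\varepsilon>0}\|D_\varepsilon\|_{\mathcal{H}_\infty(X)}<\infty .$$ Then the Bohr transform $\mathcal{B}$, which maps $F\in H_\infty(B_{c_0},X)$ to the Dirichlet series $\sum_n a_nn^{-s}$ with $a_n=c_\alpha(F)$ for $n=\mathfrak{p}^\alpha$, is a linear isometry from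 $H_\infty(B_{c_0},X)$ onto $\mathcal{H}_\infty^+(X)$. Moreover, if $\mathcal{B}(F)=\sum_n a_nn^{-s}$, then for every $s\in\mathbb{C}$ with $\operatorname{Re}s>0$ the series $\sum_{n=1}^\infty a_nn^{-s}$ converges in $X$ and $$F(\mathfrak{p}^{-s})=\sum_{n=1}^\infty a_nn^{-s},\qquad \mathfrak{p}^{-s}=(\mathfrak{p}_k^{-s})_k\in B_{c_0}.$$ -/

import Mathlib

open MeasureTheory Filter Topology
open scoped ZeroAtInfty BoundedContinuousFunction ENNReal

namespace BohrHardy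

/-! ### Primes and the Bohr correspondence `α ↔ n = 𝔭^α` -/

/-- The `k`-th prime number, counted from `k = 0`: `2, 3, 5, …`. -/
noncomputable def prime (k : ℕ) : ℕ := Nat.nth Nat.Prime k

theorem prime_prime (k : ℕ) : (prime k).Prime := Nat.prime_nth_prime k

theorem prime_injective : Function.Injective prime :=
  Nat.nth_injective Nat.infinite_setOfPred_prime

theorem exists_prime_eq {p : ℕ} (hp : p.Prime) : ∃ k, prime k = p :=
  ⟨Nat.count Nat.Prime p, Nat.nth_count hp⟩

/-- The number `𝔭^α = 𝔭₁^{α₁} 𝔭₂^{α₂} ⋯`. -/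
noncomputable def primePow (α : ℕ →₀ ℕ) : ℕ+ :=
  ⟨α.prod fun k e => prime k ^ e,
    Finset.prod_pos fun k _ => pow_pos (prime_prime k).pos _⟩

/-- The exponents of `n` in its prime factorization, listed along the sequence of primes. -/
noncomputable def exponents (n : ℕ+) : ℕ →₀ ℕ :=
  (n : ℕ).factorization.comapDomain prime prime_injective.injOn

theorem mapDomain_prime_support {α : ℕ →₀ ℕ} {p : ℕ}
    (hp : p ∈ (α.mapDomain prime).support) : p.Prime := by
  classical
  obtain ⟨k, _, rfl⟩ := Finset.mem_image.1 (Finsupp.mapDomain_support hp)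
  exact prime_prime k

theorem primePow_eq_mapDomain (α : ℕ →₀ ℕ) :
    (primePow α : ℕ) = (α.mapDomain prime).prod (· ^ ·) := by
  rw [Finsupp.prod_mapDomain_index_inj prime_injective]
  rfl

theorem exponents_primePow (α : ℕ →₀ ℕ) : exponents (primePow α) = α := by
  have h : (primePow α : ℕ).factorization = α.mapDomain prime := by
    rw [primePow_eq_mapDomain,
      Nat.prod_pow_factorization_eq_self fun p hp => mapDomain_prime_support hp]
  ext k
  rw [exponents, Finsupp.comapDomain_apply, h, Finsupp.mapDomain_apply prime_injective]

theorem primePow_exponents (n : ℕ+) : primePow (exponents n) = n := by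
  apply PNat.coe_injective
  rw [primePow_eq_mapDomain, exponents, Finsupp.mapDomain_comapDomain _ prime_injective]
  · exact Nat.prod_factorization_pow_eq_self n.ne_zero
  · intro p hp
    obtain ⟨k, hk⟩ := exists_prime_eq (Nat.prime_of_mem_primeFactors hp)
    exact ⟨k, hk⟩

/-- The bijection `α ↦ 𝔭^α` between finitely supported multi-indices and positive integers. -/
noncomputable def primePowEquiv : (ℕ →₀ ℕ) ≃ ℕ+ where
  toFun := primePow
  invFun := exponents
  left_inv := exponents_primePow
  right_inv := primePow_exponents

/-! ### The infinite-dimensional torus and `H_∞(𝕋^ℕ, X)` -/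

noncomputable instance instMeasurableSpaceCircle : MeasurableSpace Circle := borel Circle

instance instBorelSpaceCircle : BorelSpace Circle := ⟨rfl⟩

instance instSecondCountableCircle : SecondCountableTopology Circle :=
  TopologicalSpace.Subtype.secondCountableTopology (Metric.sphere (0 : ℂ) 1)

/-- The normalized Haar measure on `𝕋^ℕ`. -/
noncomputable def torusMeasure : Measure (ℕ → Circle) := Measure.haarMeasure ⊤

instance instIsHaarMeasure : torusMeasure.IsHaarMeasure := by
  unfold torusMeasure; infer_instance

instance instIsProbabilityMeasure : IsProbabilityMeasure torusMeasure :=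
  ⟨by
    unfold torusMeasure
    simpa using Measure.haarMeasure_self
      (K₀ := (⊤ : TopologicalSpace.PositiveCompacts (ℕ → Circle)))⟩

/-- The monomial `ω^α`, for an integer multi-index `α`, on the torus. -/
noncomputable def torusMonomial (α : ℕ →₀ ℤ) (ω : ℕ → Circle) : Circle :=
  α.prod fun k e => ω k ^ e

theorem continuous_torusMonomial (α : ℕ →₀ ℤ) : Continuous (torusMonomial α) := by
  unfold torusMonomial Finsupp.prod
  fun_prop

theorem torusMonomial_zero (ω : ℕ → Circle) : torusMonomial 0 ω = 1 := by
  simp [torusMonomial]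

theorem torusMonomial_add (α β : ℕ →₀ ℤ) (ω : ℕ → Circle) :
    torusMonomial (α + β) ω = torusMonomial α ω * torusMonomial β ω := by
  classical
  exact Finsupp.prod_add_index' (by simp) fun k m n => zpow_add _ _ _

theorem torusMonomial_neg (α : ℕ →₀ ℤ) (ω : ℕ → Circle) :
    torusMonomial (-α) ω = (torusMonomial α ω)⁻¹ := by
  rw [eq_inv_iff_mul_eq_one, ← torusMonomial_add, neg_add_cancel, torusMonomial_zero]

theorem torusMonomial_single (k : ℕ) (ω : ℕ → Circle) :
    torusMonomial (Finsupp.single k 1) ω = ω k := by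
  simp [torusMonomial]

variable {X : Type*} [NormedAddCommGroup X] [NormedSpace ℂ X]

theorem integrable_linfty {Y : Type*} [NormedAddCommGroup Y] (f : Lp Y ∞ torusMeasure) :
    Integrable f torusMeasure :=
  (Lp.memLp f).integrable le_top

theorem integrable_smul_linfty {g : (ℕ → Circle) → ℂ} (hg : Continuous g)
    (f : Lp X ∞ torusMeasure) : Integrable (fun ω => g ω • f ω) torusMeasure := by
  obtain ⟨C, hC⟩ := isCompact_univ.exists_bound_of_continuousOn hg.continuousOn
  exact (integrable_linfty f).bdd_smul C hg.aestronglyMeasurable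
    (ae_of_all _ fun ω => hC ω trivial)

theorem continuous_coe_torusMonomial (α : ℕ →₀ ℤ) :
    Continuous fun ω => (torusMonomial α ω : ℂ) :=
  continuous_subtype_val.comp (continuous_torusMonomial α)

/-- The Fourier coefficient `f̂(α) = ∫ f(ω) ω^{-α} dω` of `f ∈ L_∞(𝕋^ℕ, X)`. -/
noncomputable def torusCoeff (α : ℕ →₀ ℤ) : Lp X ∞ torusMeasure →ₗ[ℂ] X where
  toFun f := ∫ ω, (torusMonomial (-α) ω : ℂ) • f ω ∂torusMeasure
  map_add' f g := by
    rw [← integral_add (integrable_smul_linfty (continuous_coe_torusMonomial _) f)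
      (integrable_smul_linfty (continuous_coe_torusMonomial _) g)]
    refine integral_congr_ae ?_
    filter_upwards [Lp.coeFn_add f g] with ω hω
    rw [hω, Pi.add_apply, smul_add]
  map_smul' c f := by
    rw [RingHom.id_apply, ← integral_smul]
    refine integral_congr_ae ?_
    filter_upwards [Lp.coeFn_smul c f] with ω hω
    rw [hω, Pi.smul_apply, smul_comm]

variable (X) in
/-- The Hardy space `H_∞(𝕋^ℕ, X)`: the (classes of) essentially bounded strongly measurable
functions whose Fourier coefficients vanish off the multi-indices with entries in `ℕ₀`; its norm
is the essential supremum norm of `L_∞(𝕋^ℕ, X)`. -/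
noncomputable def HardyTorus : Submodule ℂ (Lp X ∞ torusMeasure) where
  carrier := {f | ∀ α : ℕ →₀ ℤ, (∃ k, α k < 0) → torusCoeff α f = 0}
  zero_mem' := fun α _ => map_zero _
  add_mem' := fun {f g} hf hg α hα => by rw [map_add, hf α hα, hg α hα, add_zero]
  smul_mem' := fun c f hf α hα => by rw [map_smul, hf α hα, smul_zero]

/-- A multi-index with entries in `ℕ₀`, viewed as an integer multi-index. -/
noncomputable def toIntIndex (α : ℕ →₀ ℕ) : ℕ →₀ ℤ := α.mapRange (↑) Nat.cast_zero

/-! ### Uniqueness of Fourier coefficients -/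

/-- The monomial `ω^α` as a continuous complex function. -/
noncomputable def monomialMap (α : ℕ →₀ ℤ) : C(ℕ → Circle, ℂ) :=
  ⟨fun ω => (torusMonomial α ω : ℂ), continuous_coe_torusMonomial α⟩

/-- The star subalgebra of `C(𝕋^ℕ, ℂ)` generated by the monomials. -/
noncomputable def monomialAlgebra : StarSubalgebra ℂ C(ℕ → Circle, ℂ) where
  toSubalgebra := Algebra.adjoin ℂ (Set.range monomialMap)
  star_mem' := by
    change Algebra.adjoin ℂ (Set.range monomialMap) ≤
      star (Algebra.adjoin ℂ (Set.range monomialMap))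
    refine Algebra.adjoin_le ?_
    rintro _ ⟨α, rfl⟩
    refine Algebra.subset_adjoin ⟨-α, ?_⟩
    ext ω
    change ((torusMonomial (-α) ω : Circle) : ℂ) = star (torusMonomial α ω : ℂ)
    rw [torusMonomial_neg, Circle.coe_inv_eq_conj]
    rfl

theorem monomialAlgebra_coe :
    Subalgebra.toSubmodule monomialAlgebra.toSubalgebra =
      Submodule.span ℂ (Set.range monomialMap) := by
  apply Algebra.adjoin_eq_span_of_subset
  refine .trans (fun x ↦ Submonoid.closure_induction (fun _ ↦ id) ⟨0, ?_⟩ ?_)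
    Submodule.subset_span
  · ext ω
    simp [monomialMap, torusMonomial_zero]
  · rintro _ _ _ _ ⟨m, rfl⟩ ⟨n, rfl⟩
    refine ⟨m + n, ?_⟩
    ext ω
    simp [monomialMap, torusMonomial_add]

theorem monomialAlgebra_separatesPoints : monomialAlgebra.SeparatesPoints := by
  intro x y hxy
  obtain ⟨k, hk⟩ := Function.ne_iff.1 hxy
  refine ⟨_, ⟨monomialMap (Finsupp.single k 1), Algebra.subset_adjoin ⟨_, rfl⟩, rfl⟩, ?_⟩
  simpa [monomialMap, torusMonomial_single, Circle.ext_iff] using hk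

theorem integral_smul_eq_zero {f : Lp X ∞ torusMeasure} (hf : ∀ α, torusCoeff α f = 0)
    (g : C(ℕ → Circle, ℂ)) : ∫ ω, g ω • f ω ∂torusMeasure = 0 := by
  set C : ℝ := ∫ ω, ‖f ω‖ ∂torusMeasure
  have hlin : ∀ g ∈ Submodule.span ℂ (Set.range monomialMap),
      ∫ ω, g ω • f ω ∂torusMeasure = 0 := by
    intro g hg
    induction hg using Submodule.span_induction with
    | mem g hg =>
      obtain ⟨α, rfl⟩ := hg
      have := hf (-α)
      simpa [torusCoeff, monomialMap] using this
    | zero => simp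
    | add g h _ _ hg hh =>
      simp only [ContinuousMap.add_apply, add_smul]
      rw [integral_add (integrable_smul_linfty g.continuous f)
        (integrable_smul_linfty h.continuous f), hg, hh, add_zero]
    | smul c g _ hg =>
      simp only [ContinuousMap.smul_apply, smul_eq_mul, mul_smul]
      rw [integral_smul, hg, smul_zero]
  have hdense : g ∈ closure (Submodule.span ℂ (Set.range monomialMap) :
      Set C(ℕ → Circle, ℂ)) := by
    have h := ContinuousMap.starSubalgebra_topologicalClosure_eq_top_of_separatesPoints
      monomialAlgebra monomialAlgebra_separatesPoints
    have hg : g ∈ monomialAlgebra.topologicalClosure := h ▸ trivial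
    rw [← monomialAlgebra_coe]
    exact hg
  have hcont : Continuous fun g : C(ℕ → Circle, ℂ) => ∫ ω, g ω • f ω ∂torusMeasure := by
    refine (LipschitzWith.of_dist_le_mul (K := C.toNNReal) fun g h => ?_).continuous
    rw [Real.coe_toNNReal _ (integral_nonneg fun _ => norm_nonneg _), dist_eq_norm,
      ← integral_sub (integrable_smul_linfty g.continuous f)
        (integrable_smul_linfty h.continuous f), mul_comm, ← integral_const_mul]
    refine norm_integral_le_of_norm_le ((integrable_linfty f).norm.const_mul _)
      (ae_of_all _ fun ω => ?_)
    rw [← sub_smul, norm_smul, ← dist_eq_norm]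
    gcongr
    exact ContinuousMap.dist_apply_le_dist ω
  exact closure_minimal hlin (isClosed_eq hcont continuous_const) hdense

theorem eq_zero_of_torusCoeff [CompleteSpace X] {f : Lp X ∞ torusMeasure}
    (hf : ∀ α, torusCoeff α f = 0) : f = 0 := by
  rw [Lp.eq_zero_iff_ae_eq_zero]
  refine ae_eq_zero_of_forall_setIntegral_isClosed_eq_zero (integrable_linfty f) fun s hs => ?_
  have key : Tendsto (fun n => ∫ ω, ((hs.apprSeq n ω : ℝ) : ℂ) • f ω ∂torusMeasure) atTop
      (𝓝 (∫ ω, s.indicator (fun ω => f ω) ω ∂torusMeasure)) := by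
    refine tendsto_integral_of_dominated_convergence (fun ω => ‖f ω‖) (fun n => ?_)
      (integrable_linfty f).norm (fun n => ae_of_all _ fun ω => ?_) (ae_of_all _ fun ω => ?_)
    · exact (integrable_smul_linfty (by fun_prop) f).aestronglyMeasurable
    · have h1 : ((hs.apprSeq n ω : NNReal) : ℝ) ≤ 1 :=
        HasOuterApproxClosed.apprSeq_apply_le_one hs n ω
      rw [norm_smul, Complex.norm_real, Real.norm_of_nonneg (NNReal.coe_nonneg _)]
      exact mul_le_of_le_one_left (norm_nonneg _) h1
    · have h := tendsto_pi_nhds.1 (HasOuterApproxClosed.tendsto_apprSeq hs) ω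
      have h2 : Tendsto (fun n => (((hs.apprSeq n ω : NNReal) : ℝ) : ℂ) • f ω) atTop
          (𝓝 ((((s.indicator (fun _ => (1 : NNReal)) ω : NNReal) : ℝ) : ℂ) • f ω)) := by
        refine Tendsto.smul_const ?_ _
        exact (Complex.continuous_ofReal.comp NNReal.continuous_coe).continuousAt.tendsto.comp h
      convert h2 using 2
      by_cases hω : ω ∈ s <;> simp [hω]
  rw [← integral_indicator hs.measurableSet]
  refine tendsto_nhds_unique key ?_
  have h0 : ∀ n, ∫ ω, ((hs.apprSeq n ω : ℝ) : ℂ) • f ω ∂torusMeasure = 0 := fun n =>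
    integral_smul_eq_zero hf ⟨fun ω => ((hs.apprSeq n ω : ℝ) : ℂ), by fun_prop⟩
  simp only [h0]
  exact tendsto_const_nhds

/-! ### Dirichlet series, `𝓗_∞(X)` and `𝓗_∞⁺(X)`

A (formal) Dirichlet series `∑ aₙ n^{-s}` in `X` is its sequence of coefficients `a : ℕ+ → X`. -/

variable (X) in
/-- The Bohr transform on `H_∞(𝕋^ℕ, X)`: the Dirichlet series with `aₙ = f̂(α)` for `n = 𝔭^α`. -/
noncomputable def torusBohr : HardyTorus X →ₗ[ℂ] (ℕ+ → X) where
  toFun f n := torusCoeff (toIntIndex (primePowEquiv.symm n)) (f : Lp X ∞ torusMeasure)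
  map_add' f g := by ext n; simp
  map_smul' c f := by ext n; simp

theorem torusBohr_injective [CompleteSpace X] : Function.Injective (torusBohr X) := by
  rw [injective_iff_map_eq_zero]
  intro f hf
  apply Subtype.ext
  refine eq_zero_of_torusCoeff fun α => ?_
  by_cases hα : ∃ k, α k < 0
  · exact f.2 α hα
  · push Not at hα
    have h := congrFun hf (primePowEquiv (α.mapRange Int.toNat rfl))
    have h' : toIntIndex (α.mapRange Int.toNat rfl) = α := by
      ext k
      simp [toIntIndex, hα k]
    simpa [torusBohr, h'] using h

variable (X) in
/-- `𝓗_∞(X)`: the image of `H_∞(𝕋^ℕ, X)` under the Bohr transform. -/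
noncomputable def HardyDirichlet : Submodule ℂ (ℕ+ → X) := LinearMap.range (torusBohr X)

variable (X) in
/-- The identification `H_∞(𝕋^ℕ, X) ≡ 𝓗_∞(X)`. -/
noncomputable def torusBohrEquiv [CompleteSpace X] : HardyTorus X ≃ₗ[ℂ] HardyDirichlet X :=
  LinearEquiv.ofInjective (torusBohr X) torusBohr_injective

/-- `𝓗_∞(X)` carries the norm that makes its identification with `H_∞(𝕋^ℕ, X)` isometric. -/
noncomputable instance instNormedAddCommGroupHardyDirichlet [CompleteSpace X] :
    NormedAddCommGroup (HardyDirichlet X) :=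
  NormedAddCommGroup.induced _ _ (torusBohrEquiv X).symm (torusBohrEquiv X).symm.injective

noncomputable instance instNormedSpaceHardyDirichlet [CompleteSpace X] :
    NormedSpace ℂ (HardyDirichlet X) where
  norm_smul_le c D := by
    change ‖(torusBohrEquiv X).symm (c • D)‖ ≤ ‖c‖ * ‖(torusBohrEquiv X).symm D‖
    rw [map_smul, norm_smul]

variable (X) in
/-- The translation `D ↦ D_z = ∑ (aₙ / n^z) n^{-s}` of Dirichlet series. -/
noncomputable def translate (z : ℂ) : (ℕ+ → X) →ₗ[ℂ] (ℕ+ → X) where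
  toFun a n := ((n : ℕ) : ℂ) ^ (-z) • a n
  map_add' a b := by ext n; simp
  map_smul' c a := by ext n; simp [smul_comm c]

variable (X) in
/-- `𝓗_∞⁺(X)`: the Dirichlet series `D` with `D_ε ∈ 𝓗_∞(X)` for all `ε > 0` and
`sup_{ε > 0} ‖D_ε‖_{𝓗_∞(X)} < ∞`. -/
noncomputable def HardyDirichletPlus [CompleteSpace X] : Submodule ℂ (ℕ+ → X) where
  carrier := {a | ∃ C : ℝ, ∀ ε : ℝ, 0 < ε →
    ∃ h : translate X ε a ∈ HardyDirichlet X, ‖(⟨translate X ε a, h⟩ : HardyDirichlet X)‖ ≤ C}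
  zero_mem' := ⟨0, fun ε _ => by
    refine ⟨by rw [map_zero]; exact zero_mem _, ?_⟩
    have : (⟨translate X ε 0, by rw [map_zero]; exact zero_mem _⟩ : HardyDirichlet X) = 0 :=
      Subtype.ext (map_zero _)
    rw [this, norm_zero]⟩
  add_mem' := by
    rintro a b ⟨C, hC⟩ ⟨C', hC'⟩
    refine ⟨C + C', fun ε hε => ?_⟩
    obtain ⟨h, hn⟩ := hC ε hε
    obtain ⟨h', hn'⟩ := hC' ε hε
    have hab : translate X ε (a + b) ∈ HardyDirichlet X := by
      rw [map_add]; exact add_mem h h'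
    have : (⟨_, hab⟩ : HardyDirichlet X) = ⟨_, h⟩ + ⟨_, h'⟩ := Subtype.ext (map_add _ _ _)
    exact ⟨hab, this ▸ (norm_add_le _ _).trans (add_le_add hn hn')⟩
  smul_mem' := by
    rintro c a ⟨C, hC⟩
    refine ⟨‖c‖ * C, fun ε hε => ?_⟩
    obtain ⟨h, hn⟩ := hC ε hε
    have hca : translate X ε (c • a) ∈ HardyDirichlet X := by
      rw [map_smul]; exact Submodule.smul_mem _ c h
    have : (⟨_, hca⟩ : HardyDirichlet X) = c • ⟨_, h⟩ := Subtype.ext (map_smul _ _ _)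
    exact ⟨hca, by rw [this, norm_smul]; gcongr⟩

variable (X) in
/-- `D ↦ D_ε`, for `ε > 0`, as a map from `𝓗_∞⁺(X)` to `𝓗_∞(X)`. -/
noncomputable def translatePlus [CompleteSpace X] (ε : {ε : ℝ // 0 < ε}) :
    HardyDirichletPlus X →ₗ[ℂ] HardyDirichlet X where
  toFun D := ⟨translate X (ε : ℝ) (D : ℕ+ → X), (D.2.choose_spec ε ε.2).1⟩
  map_add' _ _ := Subtype.ext (map_add _ _ _)
  map_smul' _ _ := Subtype.ext (map_smul _ _ _)

theorem bddAbove_norm_translatePlus [CompleteSpace X] (D : HardyDirichletPlus X) :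
    BddAbove (Set.range fun ε : {ε : ℝ // 0 < ε} => ‖translatePlus X ε D‖) := by
  obtain ⟨C, hC⟩ := D.2
  exact ⟨C, by rintro _ ⟨ε, rfl⟩; exact (hC ε ε.2).2⟩

/-- The norm `‖D‖ = sup_{ε > 0} ‖D_ε‖_{𝓗_∞(X)}` of `𝓗_∞⁺(X)`. -/
noncomputable instance instNormHardyDirichletPlus [CompleteSpace X] :
    Norm (HardyDirichletPlus X) :=
  ⟨fun D => ⨆ ε : {ε : ℝ // 0 < ε}, ‖translatePlus X ε D‖⟩

theorem norm_plus_def [CompleteSpace X] (D : HardyDirichletPlus X) :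
    ‖D‖ = ⨆ ε : {ε : ℝ // 0 < ε}, ‖translatePlus X ε D‖ := rfl

theorem norm_translatePlus_le [CompleteSpace X] (ε : {ε : ℝ // 0 < ε})
    (D : HardyDirichletPlus X) : ‖translatePlus X ε D‖ ≤ ‖D‖ :=
  le_ciSup (bddAbove_norm_translatePlus D) ε

instance instNonemptyPos : Nonempty {ε : ℝ // 0 < ε} := ⟨⟨1, one_pos⟩⟩

theorem normedSpaceCore [CompleteSpace X] : NormedSpace.Core ℂ (HardyDirichletPlus X) where
  norm_nonneg D := (norm_nonneg _).trans (norm_translatePlus_le ⟨1, one_pos⟩ D)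
  norm_smul c D := by
    simp only [norm_plus_def, map_smul, norm_smul]
    exact (Real.mul_iSup_of_nonneg (norm_nonneg c) _).symm
  norm_triangle D E := by
    refine ciSup_le fun ε => ?_
    rw [map_add]
    exact (norm_add_le _ _).trans
      (add_le_add (norm_translatePlus_le ε D) (norm_translatePlus_le ε E))
  norm_eq_zero_iff D := by
    constructor
    · intro h
      have h1 : translatePlus X ⟨1, one_pos⟩ D = 0 :=
        norm_le_zero_iff.1 ((norm_translatePlus_le ⟨1, one_pos⟩ D).trans h.le)
      apply Subtype.ext
      funext n
      have h2 : (((n : ℕ) : ℂ) ^ (-((1 : ℝ) : ℂ))) • (D : ℕ+ → X) n = 0 :=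
        congrFun (congrArg Subtype.val h1) n
      have hn : ((n : ℕ) : ℂ) ≠ 0 := Nat.cast_ne_zero.2 n.ne_zero
      have h3 := (smul_eq_zero.1 h2).resolve_left (by simp [Complex.cpow_eq_zero_iff, hn])
      exact h3
    · rintro rfl
      simp [norm_plus_def]

noncomputable instance instNormedAddCommGroupHardyDirichletPlus [CompleteSpace X] :
    NormedAddCommGroup (HardyDirichletPlus X) :=
  NormedAddCommGroup.ofCore normedSpaceCore

noncomputable instance instNormedSpaceHardyDirichletPlus [CompleteSpace X] :
    NormedSpace ℂ (HardyDirichletPlus X) :=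
  NormedSpace.ofCore normedSpaceCore

/-! ### Bounded holomorphic functions on the unit ball of `c₀` -/

/-- The open unit ball `B_{c₀}` of `c₀`, the space of complex null sequences with the sup norm. -/
abbrev UnitBall : Type := Metric.ball (0 : C₀(ℕ, ℂ)) 1

variable (X) in
/-- `H_∞(B_{c₀}, X)`: the bounded holomorphic (that is, complex Fréchet differentiable) functions
on the open unit ball of `c₀`, with the supremum norm. -/
noncomputable def HardyBall : Submodule ℂ (UnitBall →ᵇ X) where
  carrier := {F | ∃ G : C₀(ℕ, ℂ) → X, DifferentiableOn ℂ G (Metric.ball 0 1) ∧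
    ∀ z : UnitBall, G z = F z}
  zero_mem' := ⟨0, differentiableOn_const 0, fun _ => rfl⟩
  add_mem' := by
    rintro F F' ⟨G, hG, h⟩ ⟨G', hG', h'⟩
    exact ⟨G + G', hG.add hG', fun z => by simp [h, h']⟩
  smul_mem' := by
    rintro c F ⟨G, hG, h⟩
    exact ⟨c • G, hG.const_smul c, fun z => by simp [h]⟩

/-- The monomial `z^α = z₁^{α₁} z₂^{α₂} ⋯`. -/
noncomputable def monomial (α : ℕ →₀ ℕ) (z : ℕ → ℂ) : ℂ := α.prod fun k e => z k ^ e

/-- `F` has the monomial series expansion `F ≡ ∑ c_α z^α`: for every `m`, the restriction of `F`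
to its first `m` variables is the sum of its power series `∑ c_α z^α` at every point of `𝔻^m`.
(The sum may run over all multi-indices: `z^α = 0` at a point of `𝔻^m` if `α` involves a variable
beyond the first `m`.) -/
def HasMonomialExpansion (F : HardyBall X) (c : (ℕ →₀ ℕ) → X) : Prop :=
  ∀ (m : ℕ) (z : UnitBall), (∀ k, m ≤ k → (z : C₀(ℕ, ℂ)) k = 0) →
    HasSum (fun α => monomial α (z : C₀(ℕ, ℂ)) • c α) ((F : UnitBall →ᵇ X) z)

/-- `D = 𝓑(F)`: the Dirichlet series `D = ∑ aₙ n^{-s}` is the Bohr transform of `F`, that is,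
`F ≡ ∑ c_α z^α` with `c_α = aₙ` for `n = 𝔭^α`. -/
def IsBohrTransform (F : HardyBall X) (D : ℕ+ → X) : Prop :=
  HasMonomialExpansion F fun α => D (primePowEquiv α)

/-! ### The points `𝔭^{-s}` -/

theorem norm_prime_cpow (k : ℕ) (s : ℂ) :
    ‖(prime k : ℂ) ^ (-s)‖ = (prime k : ℝ) ^ (-s.re) := by
  rw [Complex.norm_natCast_cpow_of_pos (prime_prime k).pos, Complex.neg_re]

theorem tendsto_prime_cpow (s : ℂ) (hs : 0 < s.re) :
    Tendsto (fun k => (prime k : ℂ) ^ (-s)) atTop (𝓝 0) := by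
  rw [tendsto_zero_iff_norm_tendsto_zero]
  simp only [norm_prime_cpow]
  have hp : Tendsto prime atTop atTop :=
    (Nat.nth_strictMono Nat.infinite_setOfPred_prime).tendsto_atTop
  exact (tendsto_rpow_neg_atTop hs).comp (tendsto_natCast_atTop_atTop.comp hp)

/-- The sequence `𝔭^{-s} = (𝔭_k^{-s})_k` as an element of `c₀`, for `Re s > 0`. -/
noncomputable def primeSeq (s : ℂ) (hs : 0 < s.re) : C₀(ℕ, ℂ) where
  toFun k := (prime k : ℂ) ^ (-s)
  continuous_toFun := continuous_of_discreteTopology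
  zero_at_infty' := by
    rw [cocompact_eq_cofinite, Nat.cofinite_eq_atTop]
    exact tendsto_prime_cpow s hs

theorem primeSeq_mem (s : ℂ) (hs : 0 < s.re) :
    primeSeq s hs ∈ Metric.ball (0 : C₀(ℕ, ℂ)) 1 := by
  have h2 : (2 : ℝ) ^ (-s.re) < 1 := Real.rpow_lt_one_of_one_lt_of_neg one_lt_two (by linarith)
  rw [mem_ball_zero_iff, ← ZeroAtInftyContinuousMap.norm_toBCF_eq_norm]
  refine lt_of_le_of_lt ((BoundedContinuousFunction.norm_le (by positivity)).2 fun k => ?_) h2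
  change ‖(prime k : ℂ) ^ (-s)‖ ≤ _
  rw [norm_prime_cpow]
  exact Real.rpow_le_rpow_of_nonpos two_pos (by exact_mod_cast (prime_prime k).two_le)
    (by linarith)

/-- The point `𝔭^{-s}` of `B_{c₀}`, for `Re s > 0`. -/
noncomputable def primePoint (s : ℂ) (hs : 0 < s.re) : UnitBall :=
  ⟨primeSeq s hs, primeSeq_mem s hs⟩

end BohrHardy

open BohrHardy

namespace BohrHardy

/-! ### Pointwise limits of bounded holomorphic functions -/

section Limits

open Metric Set

variable {E Y : Type*} [NormedAddCommGroup E] [NormedSpace ℂ E]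
  [NormedAddCommGroup Y] [NormedSpace ℂ Y]

/-! Everything rests on the functions ω ↦ F(ωz) on the torus, where ωz is the coordinatewise
product. For F bounded and holomorphic on the ball, the Fourier coefficients of ω ↦ F(ωz) vanish at
every index with a negative entry (`ballCoeff_eq_zero`) and equal z^α c_α at α ≥ 0, with c_α
independent of z (`ballCoeff_eq`). Invariance of Haar measure allows averaging over one circle at a
time, which reduces both facts to Taylor series in one variable. Since (𝔭^{-ε})^α = n^{-ε} for n =
𝔭^α, the choice z = 𝔭^{-ε} gives the element of H_∞(𝕋^ℕ, X) that represents D_ε, so ‖D_ε‖ ≤ ‖F‖.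

For the converse, let z be a finitely supported point of the ball. For small ε > 0 the point u with
u_k = z_k 𝔭_k^ε still lies in the polydisc, and ∑ z^α a_n = ∑ u^α f̂(α), where f represents D_ε. The
right side is the mean of f against a positive kernel, the normalized square of the Szegő kernel, so
its norm is at most ‖D‖ (`norm_tsum_monomial_smul_le`, `norm_tsum_plus_le`). The series in the first
m variables are therefore holomorphic and bounded uniformly in m. The Schwarz lemma makes them
converge pointwise (`exists_tendsto_of_trunc`), and the limit is holomorphic
(`differentiableOn_of_tendsto_of_bounded`); this proves surjectivity. The same bound at truncations
of a point, with continuity of F, gives ‖F‖ ≤ ‖𝓑(F)‖.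

Convergence at Re s > 0 comes from a smoothed Perron formula. F is integrated along the flow
𝔭^{2πiξ}z against a kernel whose inverse Fourier transform is 0 at log n for n ≤ N and n^{-σ} for n
> N. At finitely supported z, where the monomial series converges absolutely, the integral is
exactly the remainder of the series after N terms. The L¹ norm of the kernel tends to 0 as N grows,
and the resulting bound does not depend on the number of variables, so it survives the passage to
infinitely many primes. -/

/-- Schwarz estimate: the bound C puts the image of the ball inside the closed ball of radius 2C
about f(c). -/
theorem norm_fderiv_le_of_bounded {f : E → Y} {c : E} {R C : ℝ} (hR : 0 < R)
    (hd : DifferentiableOn ℂ f (ball c R)) (hC : ∀ z ∈ ball c R, ‖f z‖ ≤ C) :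
    ‖fderiv ℂ f c‖ ≤ 2 * C / R := by
  refine Complex.norm_fderiv_le_div_of_mapsTo_ball hd (fun z hz => ?_) hR
  rw [mem_closedBall, dist_eq_norm, two_mul]
  exact (norm_sub_le _ _).trans (add_le_add (hC z hz) (hC c (mem_ball_self hR)))

theorem dist_le_of_bounded {f : E → Y} {c z : E} {R C : ℝ} (hR : 0 < R)
    (hd : DifferentiableOn ℂ f (ball c R)) (hC : ∀ z ∈ ball c R, ‖f z‖ ≤ C)
    (hz : z ∈ ball c R) : ‖f z - f c‖ ≤ 2 * C / R * ‖z - c‖ := by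
  rw [← dist_eq_norm, ← dist_eq_norm]
  refine Complex.dist_le_div_mul_dist_of_mapsTo_ball hd (fun z hz => ?_) hz
  rw [mem_closedBall, dist_eq_norm, two_mul]
  exact (norm_sub_le _ _).trans (add_le_add (hC z hz) (hC c (mem_ball_self hR)))

/-- Subtracting the linear term leaves a function bounded by 4C around its value at c and agreeing
with that value to second order, so the higher-order Schwarz lemma applies. The constant depends
only on C and R, hence is uniform over a bounded family. -/
theorem norm_sub_sub_fderiv_le {f : E → Y} {c z : E} {R C : ℝ} (hR : 0 < R)
    (hd : DifferentiableOn ℂ f (ball c R)) (hC : ∀ z ∈ ball c R, ‖f z‖ ≤ C)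
    (hz : z ∈ ball c R) :
    ‖f z - f c - fderiv ℂ f c (z - c)‖ ≤ 4 * C * (‖z - c‖ / R) ^ 2 := by
  have hC0 : 0 ≤ C := (norm_nonneg _).trans (hC c (mem_ball_self hR))
  set k : E → Y := fun w => f w - fderiv ℂ f c (w - c) with hk
  have hkd : DifferentiableOn ℂ k (ball c R) :=
    hd.sub (((fderiv ℂ f c).differentiable.comp
      (differentiable_id.sub_const c)).differentiableOn)
  have hkc : k c = f c := by simp [hk]
  have hdiff : DifferentiableAt ℂ f c := hd.differentiableAt (ball_mem_nhds c hR)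
  have ho : (fun w => k w - k c) =o[𝓝 c] fun w => ‖w - c‖ ^ 1 := by
    have h := hdiff.hasFDerivAt.isLittleO
    simp only [pow_one]
    refine (h.congr_left fun w => ?_).norm_right
    rw [hkc, hk]
    simp only
    abel
  have hmaps : MapsTo k (ball c R) (closedBall (k c) (4 * C)) := by
    intro w hw
    rw [mem_closedBall, dist_eq_norm, hkc]
    have h1 : ‖fderiv ℂ f c (w - c)‖ ≤ 2 * C / R * R :=
      ((fderiv ℂ f c).le_opNorm _).trans (mul_le_mul (norm_fderiv_le_of_bounded hR hd hC)
        (by rw [← dist_eq_norm]; exact (mem_ball.1 hw).le) (norm_nonneg _) (by positivity))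
    rw [div_mul_cancel₀ _ hR.ne'] at h1
    have h2 := hC w hw
    have h3 := hC c (mem_ball_self hR)
    calc ‖k w - f c‖ ≤ ‖f w‖ + ‖fderiv ℂ f c (w - c)‖ + ‖f c‖ :=
          (norm_sub_le _ _).trans (add_le_add (norm_sub_le _ _) le_rfl)
      _ ≤ 4 * C := by linarith
  have h := Complex.dist_le_mul_div_pow_of_mapsTo_ball_of_isLittleO hkd hmaps ho hz
  rw [dist_eq_norm, dist_eq_norm, hkc] at h
  rwa [show f z - f c - fderiv ℂ f c (z - c) = k z - f c by simp only [hk]; abel]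

/-- Difference quotients in the direction h converge because the functions do, and they approximate
the derivatives with an error uniform in i. Hence the derivatives are Cauchy along the filter. -/
theorem exists_tendsto_fderiv {ι : Type*} {l : Filter ι} [l.NeBot] [CompleteSpace Y]
    {g : ι → E → Y} {f : E → Y} {c : E} {R C : ℝ} (hR : 0 < R)
    (hd : ∀ i, DifferentiableOn ℂ (g i) (ball c R)) (hC : ∀ i, ∀ z ∈ ball c R, ‖g i z‖ ≤ C)
    (hlim : ∀ z ∈ ball c R, Tendsto (fun i => g i z) l (𝓝 (f z))) (h : E) :
    ∃ y, Tendsto (fun i => fderiv ℂ (g i) c h) l (𝓝 y) := by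
  rw [← cauchy_map_iff_exists_tendsto, cauchy_map_iff]
  refine ⟨inferInstance, ?_⟩
  have hC0 : 0 ≤ C := by
    obtain ⟨i⟩ := l.nonempty_of_neBot
    exact (norm_nonneg _).trans (hC i c (mem_ball_self hR))
  rw [Metric.uniformity_basis_dist.tendsto_right_iff]
  intro ε hε
  set K : ℝ := 4 * C * (‖h‖ / R) ^ 2 with hK
  have hK0 : 0 ≤ K := by positivity
  -- With this t each of the two second-order errors is at most tε/4. The difference of increments
  -- contributes another tε/4, so the total stays below tε.
  obtain ⟨t, ht0, ht1, ht2⟩ : ∃ t : ℝ, 0 < t ∧ t * ‖h‖ < R ∧ K * t < ε / 4 := by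
    have h1 : Tendsto (fun t : ℝ => t * ‖h‖) (𝓝[>] 0) (𝓝 0) := by
      have : Tendsto (fun t : ℝ => t * ‖h‖) (𝓝 0) (𝓝 (0 * ‖h‖)) :=
        (continuous_id.mul continuous_const).tendsto 0
      rw [zero_mul] at this
      exact this.mono_left nhdsWithin_le_nhds
    have h2 : Tendsto (fun t : ℝ => K * t) (𝓝[>] 0) (𝓝 0) := by
      have : Tendsto (fun t : ℝ => K * t) (𝓝 0) (𝓝 (K * 0)) :=
        (continuous_const.mul continuous_id).tendsto 0
      rw [mul_zero] at this
      exact this.mono_left nhdsWithin_le_nhds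
    obtain ⟨t, h3, h4, h5⟩ := ((eventually_mem_nhdsWithin (a := (0 : ℝ)) (s := Set.Ioi 0)).and
      ((h1.eventually (gt_mem_nhds hR)).and
        (h2.eventually (gt_mem_nhds (by positivity : 0 < ε / 4))))).exists
    exact ⟨t, h3, h4, h5⟩
  have hmem : c + (t : ℂ) • h ∈ ball c R := by
    rw [mem_ball, dist_eq_norm, add_sub_cancel_left, norm_smul, Complex.norm_real,
      Real.norm_of_nonneg ht0.le]
    exact ht1
  have hquad : ∀ i, ‖g i (c + (t : ℂ) • h) - g i c - (t : ℂ) • fderiv ℂ (g i) c h‖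
      ≤ K * t * t := by
    intro i
    have := norm_sub_sub_fderiv_le hR (hd i) (hC i) hmem
    rw [add_sub_cancel_left, map_smul, norm_smul, Complex.norm_real,
      Real.norm_of_nonneg ht0.le] at this
    refine this.trans (le_of_eq ?_)
    rw [hK]; ring
  have hD : Tendsto (fun i => g i (c + (t : ℂ) • h) - g i c) l
      (𝓝 (f (c + (t : ℂ) • h) - f c)) :=
    (hlim _ hmem).sub (hlim _ (mem_ball_self hR))
  have hDc := (cauchy_map_iff.1 hD.cauchy_map).2
  rw [Metric.uniformity_basis_dist.tendsto_right_iff] at hDc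
  filter_upwards [hDc (t * (ε / 4)) (by positivity)] with p hp
  change dist _ _ < _ at hp ⊢
  have e : (t : ℂ) • (fderiv ℂ (g p.1) c h - fderiv ℂ (g p.2) c h) =
      ((g p.1 (c + (t : ℂ) • h) - g p.1 c) - (g p.2 (c + (t : ℂ) • h) - g p.2 c))
      - (g p.1 (c + (t : ℂ) • h) - g p.1 c - (t : ℂ) • fderiv ℂ (g p.1) c h)
      + (g p.2 (c + (t : ℂ) • h) - g p.2 c - (t : ℂ) • fderiv ℂ (g p.2) c h) := by
    rw [smul_sub]; abel
  have hn : t * ‖fderiv ℂ (g p.1) c h - fderiv ℂ (g p.2) c h‖ < t * ε := by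
    rw [dist_eq_norm] at hp
    have h1 := congrArg norm e
    rw [norm_smul, Complex.norm_real, Real.norm_of_nonneg ht0.le] at h1
    rw [h1]
    refine (norm_add_le _ _).trans_lt ?_
    have h2 := norm_sub_le
      ((g p.1 (c + (t : ℂ) • h) - g p.1 c) - (g p.2 (c + (t : ℂ) • h) - g p.2 c))
      (g p.1 (c + (t : ℂ) • h) - g p.1 c - (t : ℂ) • fderiv ℂ (g p.1) c h)
    have h3 := hquad p.1
    have h4 := hquad p.2
    have h5 : K * t * t ≤ ε / 4 * t := by gcongr
    nlinarith
  rw [dist_eq_norm]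
  exact lt_of_mul_lt_mul_left hn ht0.le

/-- A pointwise limit of uniformly bounded holomorphic functions on a ball is holomorphic. -/
theorem differentiableOn_of_tendsto_of_bounded {ι : Type*} {l : Filter ι} [l.NeBot]
    [CompleteSpace Y] {g : ι → E → Y} {f : E → Y} {c : E} {R C : ℝ}
    (hd : ∀ i, DifferentiableOn ℂ (g i) (ball c R)) (hC : ∀ i, ∀ z ∈ ball c R, ‖g i z‖ ≤ C)
    (hlim : ∀ z ∈ ball c R, Tendsto (fun i => g i z) l (𝓝 (f z))) :
    DifferentiableOn ℂ f (ball c R) := by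
  intro a ha
  refine DifferentiableAt.differentiableWithinAt ?_
  set r : ℝ := R - dist a c with hr
  have hr0 : 0 < r := sub_pos.2 ha
  have hsub : ball a r ⊆ ball c R := ball_subset_ball' (by rw [hr]; linarith)
  have hd' := fun i => (hd i).mono hsub
  have hC' : ∀ i, ∀ z ∈ ball a r, ‖g i z‖ ≤ C := fun i z hz => hC i z (hsub hz)
  have hlim' : ∀ z ∈ ball a r, Tendsto (fun i => g i z) l (𝓝 (f z)) :=
    fun z hz => hlim z (hsub hz)
  -- The candidate derivative is the pointwise limit of the derivatives. Linearity, the operator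
  -- bound and the quadratic remainder estimate all pass to the limit.
  choose L hL using exists_tendsto_fderiv hr0 hd' hC' hlim'
  have hadd : ∀ h k, L (h + k) = L h + L k := fun h k => by
    refine tendsto_nhds_unique (hL (h + k)) ?_
    simpa only [map_add] using (hL h).add (hL k)
  have hsmul : ∀ (x : ℂ) h, L (x • h) = x • L h := fun x h => by
    refine tendsto_nhds_unique (hL (x • h)) ?_
    simpa only [map_smul] using (hL h).const_smul x
  have hbd : ∀ h, ‖L h‖ ≤ 2 * C / r * ‖h‖ := fun h => by
    refine le_of_tendsto (hL h).norm (Eventually.of_forall fun i => ?_)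
    refine ((fderiv ℂ (g i) a).le_opNorm h).trans ?_
    gcongr
    exact norm_fderiv_le_of_bounded hr0 (hd' i) (hC' i)
  let L' : E →L[ℂ] Y := LinearMap.mkContinuous ⟨⟨L, hadd⟩, hsmul⟩ _ hbd
  refine HasFDerivAt.differentiableAt (f' := L') ?_
  have hq : ∀ z ∈ ball a r, ‖f z - f a - L' (z - a)‖ ≤ 4 * C / r ^ 2 * ‖‖z - a‖ ^ 2‖ := by
    intro z hz
    have h1 : Tendsto (fun i => ‖g i z - g i a - fderiv ℂ (g i) a (z - a)‖) l
        (𝓝 ‖f z - f a - L' (z - a)‖) :=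
      (((hlim' z hz).sub (hlim' a (mem_ball_self hr0))).sub (hL (z - a))).norm
    refine le_of_tendsto h1 (Eventually.of_forall fun i => ?_)
    refine (norm_sub_sub_fderiv_le hr0 (hd' i) (hC' i) hz).trans (le_of_eq ?_)
    rw [norm_pow, norm_norm, div_pow]
    ring
  refine HasFDerivAt.of_isLittleO ?_
  have hO : (fun z => f z - f a - L' (z - a)) =O[𝓝 a] fun z => ‖z - a‖ ^ 2 :=
    Asymptotics.IsBigO.of_bound _ (by
      filter_upwards [ball_mem_nhds a hr0] with z hz using hq z hz)
  refine hO.trans_isLittleO ?_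
  exact Asymptotics.IsLittleO.of_norm_right ((Asymptotics.isLittleO_pow_id (𝕜 := ℝ)
    one_lt_two).comp_tendsto (tendsto_norm_sub_self a))

end Limits

/-! ### Null sequences -/

section NullSequences

open Metric

theorem norm_apply_le_norm (z : C₀(ℕ, ℂ)) (k : ℕ) : ‖z k‖ ≤ ‖z‖ := by
  rw [← ZeroAtInftyContinuousMap.norm_toBCF_eq_norm]
  exact z.toBCF.norm_coe_le_norm k

theorem norm_le_of_apply_le {z : C₀(ℕ, ℂ)} {r : ℝ} (hr : 0 ≤ r) (h : ∀ k, ‖z k‖ ≤ r) :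
    ‖z‖ ≤ r := by
  rw [← ZeroAtInftyContinuousMap.norm_toBCF_eq_norm]
  exact (BoundedContinuousFunction.norm_le hr).2 h

theorem tendsto_apply_zero (z : C₀(ℕ, ℂ)) : Tendsto (fun k => z k) atTop (𝓝 0) := by
  have := z.zero_at_infty'
  rwa [cocompact_eq_cofinite, Nat.cofinite_eq_atTop] at this

/-- A sequence dominated by a null sequence, as an element of `c₀`. -/
def ofDominated (b : C₀(ℕ, ℂ)) (u : ℕ → ℂ) (h : ∀ k, ‖u k‖ ≤ ‖b k‖) : C₀(ℕ, ℂ) where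
  toFun := u
  continuous_toFun := continuous_of_discreteTopology
  zero_at_infty' := by
    rw [cocompact_eq_cofinite, Nat.cofinite_eq_atTop]
    exact squeeze_zero_norm h (tendsto_zero_iff_norm_tendsto_zero.1 (tendsto_apply_zero b))

theorem norm_le_of_dominated {b z : C₀(ℕ, ℂ)} (h : ∀ k, ‖z k‖ ≤ ‖b k‖) : ‖z‖ ≤ ‖b‖ :=
  norm_le_of_apply_le (norm_nonneg _) fun k => (h k).trans (norm_apply_le_norm b k)

theorem mem_ball_of_dominated {b z : C₀(ℕ, ℂ)} (h : ∀ k, ‖z k‖ ≤ ‖b k‖) {r : ℝ}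
    (hb : b ∈ ball 0 r) : z ∈ ball 0 r := by
  rw [mem_ball_zero_iff] at hb ⊢
  exact (norm_le_of_dominated h).trans_lt hb

theorem norm_apply_lt_one {z : C₀(ℕ, ℂ)} (hz : z ∈ ball 0 1) (k : ℕ) : ‖z k‖ < 1 :=
  (norm_apply_le_norm z k).trans_lt (mem_ball_zero_iff.1 hz)

/-- Dominated coordinatewise convergence implies convergence in `c₀`. -/
theorem tendsto_of_dominated {ι : Type*} {l : Filter ι} {u : ι → C₀(ℕ, ℂ)} {v : C₀(ℕ, ℂ)}
    (b : C₀(ℕ, ℂ)) (hb : ∀ i k, ‖u i k‖ ≤ ‖b k‖) (hv : ∀ k, ‖v k‖ ≤ ‖b k‖)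
    (h : ∀ k, Tendsto (fun i => u i k) l (𝓝 (v k))) : Tendsto u l (𝓝 v) := by
  rw [Metric.tendsto_nhds]
  intro ε hε
  obtain ⟨K, hK⟩ := Filter.eventually_atTop.1 ((tendsto_zero_iff_norm_tendsto_zero.1
    (tendsto_apply_zero b)).eventually (gt_mem_nhds (by positivity : 0 < ε / 4)))
  have h1 : ∀ᶠ i in l, ∀ k ∈ Finset.range K, dist (u i k) (v k) < ε / 2 :=
    (Filter.eventually_all_finset _).2 fun k _ =>
      Metric.tendsto_nhds.1 (h k) _ (by positivity)
  filter_upwards [h1] with i hi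
  rw [dist_eq_norm]
  refine lt_of_le_of_lt (norm_le_of_apply_le (r := ε / 2) (by positivity) fun k => ?_)
    (by linarith)
  rw [ZeroAtInftyContinuousMap.sub_apply]
  by_cases hk : k < K
  · rw [← dist_eq_norm]
    exact (hi k (Finset.mem_range.2 hk)).le
  · have := hK k (not_lt.1 hk)
    have h2 := hb i k
    have h3 := hv k
    exact (norm_sub_le _ _).trans (by linarith)

/-- Coordinatewise multiplication of a null sequence by a point of the torus. -/
noncomputable def rot (ω : ℕ → Circle) (z : C₀(ℕ, ℂ)) : C₀(ℕ, ℂ) :=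
  ofDominated z (fun k => ω k * z k) fun k => by
    rw [norm_mul, Circle.norm_coe, one_mul]

theorem rot_apply (ω : ℕ → Circle) (z : C₀(ℕ, ℂ)) (k : ℕ) : rot ω z k = ω k * z k := rfl

theorem rot_one (z : C₀(ℕ, ℂ)) : rot 1 z = z := by
  ext k
  simp [rot_apply]

theorem norm_rot_apply (ω : ℕ → Circle) (z : C₀(ℕ, ℂ)) (k : ℕ) : ‖rot ω z k‖ = ‖z k‖ := by
  rw [rot_apply, norm_mul, Circle.norm_coe, one_mul]

theorem rot_mem_ball {z : C₀(ℕ, ℂ)} {r : ℝ} (hz : z ∈ ball 0 r) (ω : ℕ → Circle) :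
    rot ω z ∈ ball 0 r :=
  mem_ball_of_dominated (fun k => (norm_rot_apply ω z k).le) hz

theorem continuous_rot (z : C₀(ℕ, ℂ)) : Continuous fun ω => rot ω z := by
  refine continuous_iff_continuousAt.2 fun ω => ?_
  refine tendsto_of_dominated z (fun _ k => (norm_rot_apply _ z k).le)
    (fun k => (norm_rot_apply _ z k).le) fun k => ?_
  simp only [rot_apply]
  exact Continuous.tendsto (by fun_prop) ω

/-- The first `m` terms of a null sequence. -/
noncomputable def trunc (m : ℕ) (z : C₀(ℕ, ℂ)) : C₀(ℕ, ℂ) :=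
  ofDominated z (fun k => if k < m then z k else 0) fun k => by split_ifs <;> simp

theorem trunc_apply (m : ℕ) (z : C₀(ℕ, ℂ)) (k : ℕ) :
    trunc m z k = if k < m then z k else 0 := rfl

theorem trunc_apply_eq_zero {m k : ℕ} (hk : m ≤ k) (z : C₀(ℕ, ℂ)) : trunc m z k = 0 := by
  rw [trunc_apply, if_neg (not_lt.2 hk)]

theorem norm_trunc_apply_le (m : ℕ) (z : C₀(ℕ, ℂ)) (k : ℕ) : ‖trunc m z k‖ ≤ ‖z k‖ := by
  rw [trunc_apply]
  split_ifs <;> simp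

theorem trunc_mem_ball {z : C₀(ℕ, ℂ)} {r : ℝ} (hz : z ∈ ball 0 r) (m : ℕ) :
    trunc m z ∈ ball 0 r :=
  mem_ball_of_dominated (norm_trunc_apply_le m z) hz

theorem tendsto_trunc (z : C₀(ℕ, ℂ)) : Tendsto (fun m => trunc m z) atTop (𝓝 z) := by
  refine tendsto_of_dominated z (fun m => norm_trunc_apply_le m z) (fun _ => le_rfl) fun k => ?_
  refine tendsto_const_nhds.congr' ?_
  filter_upwards [Filter.eventually_gt_atTop k] with m hm
  rw [trunc_apply, if_pos hm]

theorem trunc_eq_self {m : ℕ} {z : C₀(ℕ, ℂ)} (hz : ∀ k, m ≤ k → z k = 0) : trunc m z = z := by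
  ext k
  rw [trunc_apply]
  split_ifs with h
  · rfl
  · exact (hz k (not_lt.1 h)).symm

theorem trunc_trunc {m n : ℕ} (h : m ≤ n) (z : C₀(ℕ, ℂ)) : trunc n (trunc m z) = trunc m z :=
  trunc_eq_self fun _ hk => trunc_apply_eq_zero (h.trans hk) z

/-- The unit vectors of `c₀`. -/
def unitVec (k : ℕ) : C₀(ℕ, ℂ) where
  toFun := Pi.single k 1
  continuous_toFun := continuous_of_discreteTopology
  zero_at_infty' := by
    rw [cocompact_eq_cofinite, Nat.cofinite_eq_atTop]
    refine tendsto_const_nhds.congr' ?_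
    filter_upwards [Filter.eventually_gt_atTop k] with m hm
    rw [Pi.single_eq_of_ne hm.ne']

theorem unitVec_apply (k j : ℕ) : unitVec k j = if j = k then 1 else 0 :=
  Pi.single_apply k 1 j

/-- Replacing a coordinate of a null sequence. -/
noncomputable def setCoord (z : C₀(ℕ, ℂ)) (k : ℕ) (ζ : ℂ) : C₀(ℕ, ℂ) :=
  z + (ζ - z k) • unitVec k

theorem setCoord_apply (z : C₀(ℕ, ℂ)) (k : ℕ) (ζ : ℂ) (j : ℕ) :
    setCoord z k ζ j = if j = k then ζ else z j := by
  rw [setCoord, ZeroAtInftyContinuousMap.add_apply, ZeroAtInftyContinuousMap.smul_apply,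
    unitVec_apply]
  split_ifs with h
  · simp [h]
  · simp

theorem differentiable_setCoord (z : C₀(ℕ, ℂ)) (k : ℕ) : Differentiable ℂ (setCoord z k) := by
  unfold setCoord
  fun_prop

theorem setCoord_mem_ball {z : C₀(ℕ, ℂ)} (hz : z ∈ ball 0 1) (k : ℕ) {ζ : ℂ}
    (hζ : ζ ∈ ball 0 1) : setCoord z k ζ ∈ ball 0 1 := by
  rw [mem_ball_zero_iff] at *
  refine lt_of_le_of_lt (norm_le_of_apply_le (r := max ‖z‖ ‖ζ‖) (by positivity) fun j => ?_)
    (max_lt hz hζ)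
  rw [setCoord_apply]
  split_ifs
  · exact le_max_right _ _
  · exact (norm_apply_le_norm z j).trans (le_max_left _ _)

end NullSequences

/-! ### Monomials -/

section Monomials

theorem monomial_eq_prod_range {m : ℕ} {z : ℕ → ℂ} (hz : ∀ k, m ≤ k → z k = 0) (α : ℕ →₀ ℕ) :
    monomial α z = if α.support ⊆ Finset.range m then ∏ k ∈ Finset.range m, z k ^ α k else 0 := by
  split_ifs with h
  · exact Finsupp.prod_of_support_subset _ h _ fun k _ => pow_zero _
  · obtain ⟨k, hk, hkm⟩ := Finset.not_subset.1 h
    refine Finset.prod_eq_zero hk ?_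
    change z k ^ α k = 0
    rw [hz k (by simpa using hkm)]
    exact zero_pow (Finsupp.mem_support_iff.1 hk)

theorem monomial_mul (α : ℕ →₀ ℕ) (z w : ℕ → ℂ) :
    monomial α (fun k => z k * w k) = monomial α z * monomial α w := by
  simp [monomial, mul_pow, Finsupp.prod_mul]

theorem monomial_add (α β : ℕ →₀ ℕ) (z : ℕ → ℂ) :
    monomial (α + β) z = monomial α z * monomial β z :=
  Finsupp.prod_add_index' (fun _ => pow_zero _) fun _ _ _ => pow_add _ _ _

theorem monomial_zero (z : ℕ → ℂ) : monomial 0 z = 1 := Finsupp.prod_zero_index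

theorem norm_monomial (α : ℕ →₀ ℕ) (z : ℕ → ℂ) :
    ‖monomial α z‖ = α.prod fun k e => ‖z k‖ ^ e := by
  simp [monomial, Finsupp.prod, norm_prod]

theorem norm_monomial_le_of_le {z w : ℕ → ℂ} (h : ∀ k, ‖z k‖ ≤ ‖w k‖) (α : ℕ →₀ ℕ) :
    ‖monomial α z‖ ≤ ‖monomial α w‖ := by
  rw [norm_monomial, norm_monomial]
  exact Finset.prod_le_prod (fun _ _ => by positivity) fun k _ =>
    pow_le_pow_left₀ (norm_nonneg _) (h k) _

theorem norm_monomial_le_one {z : ℕ → ℂ} (h : ∀ k, ‖z k‖ ≤ 1) (α : ℕ →₀ ℕ) :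
    ‖monomial α z‖ ≤ 1 := by
  rw [norm_monomial]
  exact Finset.prod_le_one (fun _ _ => by positivity) fun k _ =>
    pow_le_one₀ (norm_nonneg _) (h k)

theorem monomial_circle (α : ℕ →₀ ℕ) (ω : ℕ → Circle) :
    monomial α (fun k => (ω k : ℂ)) = torusMonomial (toIntIndex α) ω := by
  rw [torusMonomial, toIntIndex, Finsupp.prod_mapRange_index (fun _ => zpow_zero _)]
  simp only [monomial, Finsupp.prod, zpow_natCast]
  refine Eq.trans ?_ (map_prod Circle.coeHom _ _).symm
  simp only [map_pow]
  rfl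

theorem monomial_rot (α : ℕ →₀ ℕ) (ω : ℕ → Circle) (z : C₀(ℕ, ℂ)) :
    monomial α (rot ω z) = torusMonomial (toIntIndex α) ω * monomial α z := by
  rw [← monomial_circle, ← monomial_mul]
  rfl

/-- Only multi-indices supported in the first m variables contribute, and any finite set of them
lies in a box. The sum over a box factors into partial geometric sums. -/
theorem summable_norm_monomial {m : ℕ} {z : ℕ → ℂ} (hz : ∀ k, m ≤ k → z k = 0)
    (h1 : ∀ k, ‖z k‖ < 1) : Summable fun α => ‖monomial α z‖ := by
  classical
  refine summable_of_sum_le (c := ∏ k : Fin m, (1 - ‖z k‖)⁻¹) (fun _ => norm_nonneg _)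
    fun u => ?_
  set u' := u.filter fun α => α.support ⊆ Finset.range m with hu'
  have e1 : ∑ α ∈ u, ‖monomial α z‖ = ∑ α ∈ u', ∏ k : Fin m, ‖z k‖ ^ α k := by
    rw [hu', Finset.sum_filter]
    refine Finset.sum_congr rfl fun α _ => ?_
    rw [monomial_eq_prod_range hz]
    split_ifs
    · rw [norm_prod, Finset.prod_range]
      simp
    · exact norm_zero
  have hinj : Set.InjOn (fun (α : ℕ →₀ ℕ) (k : Fin m) => α k) u' := by
    intro α hα β hβ h
    have hα' := (Finset.mem_filter.1 hα).2
    have hβ' := (Finset.mem_filter.1 hβ).2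
    ext k
    by_cases hk : k < m
    · exact congrFun h ⟨k, hk⟩
    · rw [Finsupp.notMem_support_iff.1 fun h => hk (Finset.mem_range.1 (hα' h)),
        Finsupp.notMem_support_iff.1 fun h => hk (Finset.mem_range.1 (hβ' h))]
  rw [e1, ← Finset.sum_image (f := fun p : Fin m → ℕ => ∏ k : Fin m, ‖z k‖ ^ p k) hinj]
  calc _ ≤ ∑ p ∈ Fintype.piFinset fun k : Fin m => u'.image fun α => α k,
          ∏ k : Fin m, ‖z k‖ ^ p k := by
        refine Finset.sum_le_sum_of_subset_of_nonneg ?_ fun _ _ _ => by positivity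
        intro p hp
        obtain ⟨α, hα, rfl⟩ := Finset.mem_image.1 hp
        exact Fintype.mem_piFinset.2 fun k => Finset.mem_image.2 ⟨α, hα, rfl⟩
    _ = ∏ k : Fin m, ∑ j ∈ u'.image fun α => α k, ‖z k‖ ^ j :=
        (Finset.prod_univ_sum _ _).symm
    _ ≤ ∏ k : Fin m, (1 - ‖z k‖)⁻¹ := by
        refine Finset.prod_le_prod (fun _ _ => Finset.sum_nonneg fun _ _ => by positivity)
          fun k _ => ?_
        rw [← tsum_geometric_of_lt_one (norm_nonneg _) (h1 k)]
        exact (summable_geometric_of_lt_one (norm_nonneg _) (h1 k)).sum_le_tsum _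
          fun _ _ => by positivity

end Monomials

/-! ### Fourier coefficients of a holomorphic function on a circle -/

section OneVariable

open Metric Real

variable {X : Type*} [NormedAddCommGroup X] [NormedSpace ℂ X]

theorem integral_exp_int_mul_I (k : ℤ) :
    ∫ t in (0 : ℝ)..2 * π, Complex.exp (k * t * Complex.I) = if k = 0 then (2 * π : ℂ) else 0 := by
  split_ifs with h
  · simp [h]
  · have hc : (k * Complex.I : ℂ) ≠ 0 := mul_ne_zero (Int.cast_ne_zero.2 h) Complex.I_ne_zero
    have e : ∀ t : ℝ, (k * t * Complex.I : ℂ) = k * Complex.I * t := fun t => by ring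
    simp only [e]
    rw [integral_exp_mul_complex hc]
    have : Complex.exp (k * Complex.I * ((2 * π : ℝ) : ℂ)) = 1 := by
      rw [← Complex.exp_int_mul_two_pi_mul_I k]
      congr 1
      push_cast
      ring
    rw [this]
    simp

/-- At a radius r strictly between ‖w‖ and 1 the terms are bounded, so at w they are dominated by a
geometric series of ratio ‖w‖/r. -/
theorem summable_norm_taylor {g : ℂ → X} {c : ℕ → X}
    (hc : ∀ z ∈ ball (0 : ℂ) 1, HasSum (fun n => z ^ n • c n) (g z)) {w : ℂ}
    (hw : w ∈ ball 0 1) : Summable fun n => ‖w‖ ^ n * ‖c n‖ := by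
  rw [mem_ball_zero_iff] at hw
  obtain ⟨r, hr, hr1⟩ := exists_between hw
  have hr0 : 0 < r := (norm_nonneg w).trans_lt hr
  have h0 : Tendsto (fun n => (r : ℂ) ^ n • c n) atTop (𝓝 0) :=
    (hc r (by rw [mem_ball_zero_iff, Complex.norm_real, Real.norm_of_nonneg hr0.le]; exact hr1)
      ).summable.tendsto_atTop_zero
  obtain ⟨M, hM⟩ := h0.norm.bddAbove_range
  have hM' : ∀ n, r ^ n * ‖c n‖ ≤ M := fun n => by
    have := hM ⟨n, rfl⟩
    simpa [norm_smul, abs_of_pos hr0] using this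
  refine Summable.of_nonneg_of_le (fun n => by positivity) (fun n => ?_)
    ((summable_geometric_of_lt_one (by positivity) ((div_lt_one hr0).2 hr)).mul_left M)
  calc ‖w‖ ^ n * ‖c n‖ = r ^ n * ‖c n‖ * (‖w‖ / r) ^ n := by
        have := (pow_pos hr0 n).ne'
        rw [div_pow]
        field_simp
    _ ≤ M * (‖w‖ / r) ^ n := by
        gcongr
        exact hM' n

/-- The c n are the Taylor coefficients of g, and the series is integrated termwise. The point of
this form is that one sequence c serves every w, so the dependence on w is the explicit power. -/
theorem exists_circle_coeff [CompleteSpace X] {g : ℂ → X} (hg : DifferentiableOn ℂ g (ball 0 1)) :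
    ∃ c : ℕ → X, ∀ w ∈ ball (0 : ℂ) 1, ∀ a : ℤ,
      ∫ t in (0 : ℝ)..2 * π, Complex.exp (((-a : ℤ) : ℂ) * t * Complex.I) •
        g (w * Complex.exp (t * Complex.I)) =
      if 0 ≤ a then (2 * π : ℂ) • w ^ a.toNat • c a.toNat else 0 := by
  obtain ⟨c, hc⟩ : ∃ c : ℕ → X, ∀ z ∈ ball (0 : ℂ) 1, HasSum (fun n => z ^ n • c n) (g z) := by
    refine ⟨fun n => (n.factorial : ℂ)⁻¹ • iteratedDeriv n g 0, fun z hz => ?_⟩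
    have := Complex.hasSum_taylorSeries_on_ball hg hz
    simp only [sub_zero] at this
    convert this using 2 with n
    rw [smul_comm]
  refine ⟨c, fun w hw a => ?_⟩
  have hmem : ∀ t : ℝ, w * Complex.exp (t * Complex.I) ∈ ball (0 : ℂ) 1 := fun t => by
    rw [mem_ball_zero_iff] at hw ⊢
    rwa [norm_mul, Complex.norm_exp_ofReal_mul_I, mul_one]
  have hexp : ∀ (n : ℕ) (t : ℝ), Complex.exp (((-a : ℤ) : ℂ) * t * Complex.I) •
      (w * Complex.exp (t * Complex.I)) ^ n • c n =
      Complex.exp (((n - a : ℤ) : ℂ) * t * Complex.I) • w ^ n • c n := by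
    intro n t
    rw [mul_pow, smul_smul, smul_smul, ← Complex.exp_nat_mul, mul_left_comm, ← Complex.exp_add,
      mul_comm]
    congr 3
    push_cast
    ring
  have hsum := intervalIntegral.hasSum_integral_of_dominated_convergence
    (μ := volume) (a := 0) (b := 2 * π)
    (F := fun (n : ℕ) (t : ℝ) => Complex.exp (((n - a : ℤ) : ℂ) * t * Complex.I) • w ^ n • c n)
    (f := fun t : ℝ => Complex.exp (((-a : ℤ) : ℂ) * t * Complex.I) •
        g (w * Complex.exp (t * Complex.I)))
    (fun n _ => ‖w‖ ^ n * ‖c n‖) (fun n => ?_) (fun n => ?_) ?_ ?_ ?_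
  · have hterm : ∀ n : ℕ, ∫ t in (0 : ℝ)..2 * π,
        Complex.exp (((n - a : ℤ) : ℂ) * t * Complex.I) • w ^ n • c n =
        (if (n : ℤ) - a = 0 then (2 * π : ℂ) else 0) • w ^ n • c n := fun n => by
      rw [intervalIntegral.integral_smul_const, integral_exp_int_mul_I]
    simp only [hterm] at hsum
    refine hsum.unique ?_
    -- Orthogonality leaves only the term n = a, which does not exist when a is negative.
    split_ifs with ha
    · convert hasSum_single a.toNat fun n hn => ?_ using 1
      · rw [if_pos (by omega)]
      · rw [if_neg (by omega), zero_smul]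
    · convert hasSum_zero using 1
      ext n
      rw [if_neg (by omega), zero_smul]
  · exact (Continuous.aestronglyMeasurable (by fun_prop))
  · refine ae_of_all _ fun t _ => ?_
    rw [norm_smul, norm_smul, norm_pow]
    have : ‖Complex.exp (((n - a : ℤ) : ℂ) * t * Complex.I)‖ = 1 := by
      have := Complex.norm_exp_ofReal_mul_I (((n - a : ℤ) : ℝ) * t)
      push_cast at this ⊢
      exact this
    rw [this, one_mul]
  · exact ae_of_all _ fun t _ => summable_norm_taylor hc hw
  · exact intervalIntegrable_const
  · refine ae_of_all _ fun t _ => ?_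
    simp only [← hexp]
    exact (hc _ (hmem t)).const_smul _

end OneVariable

/-! ### Fourier coefficients of a bounded holomorphic function on polytori -/

section TorusFourier

open Metric

variable {X : Type*} [NormedAddCommGroup X] [NormedSpace ℂ X]

theorem norm_torusMonomial (α : ℕ →₀ ℤ) (ω : ℕ → Circle) : ‖(torusMonomial α ω : ℂ)‖ = 1 :=
  Circle.norm_coe _

theorem continuous_comp_rot {Y : Type*} [TopologicalSpace Y] {F : C₀(ℕ, ℂ) → Y}
    (hF : ContinuousOn F (ball 0 1)) {z : C₀(ℕ, ℂ)}
    (hz : z ∈ ball 0 1) : Continuous fun ω => F (rot ω z) :=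
  hF.comp_continuous (continuous_rot z) (rot_mem_ball hz)

/-- The Fourier coefficient of `ω ↦ F(ω z)`. -/
noncomputable def ballCoeff (F : C₀(ℕ, ℂ) → X) (z : C₀(ℕ, ℂ)) (α : ℕ →₀ ℤ) : X :=
  ∫ ω, (torusMonomial (-α) ω : ℂ) • F (rot ω z) ∂torusMeasure

theorem norm_ballCoeff_le {F : C₀(ℕ, ℂ) → X} {C : ℝ} (hC : ∀ z ∈ ball 0 1, ‖F z‖ ≤ C)
    {z : C₀(ℕ, ℂ)} (hz : z ∈ ball 0 1) (α : ℕ →₀ ℤ) : ‖ballCoeff F z α‖ ≤ C := by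
  have h := norm_integral_le_of_norm_le_const (μ := torusMeasure) (C := C)
    (f := fun ω => (torusMonomial (-α) ω : ℂ) • F (rot ω z)) (ae_of_all _ fun ω => by
      rw [norm_smul, norm_torusMonomial, one_mul]
      exact hC _ (rot_mem_ball hz ω))
  simpa [ballCoeff] using h

theorem rot_sub (ω : ℕ → Circle) (y z : C₀(ℕ, ℂ)) : rot ω y - rot ω z = rot ω (y - z) := by
  ext k
  simp [rot_apply, mul_sub]

theorem continuous_rot_right (ω : ℕ → Circle) : Continuous (rot ω) := by
  refine (LipschitzWith.of_dist_le_mul (K := 1) fun y z => ?_).continuous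
  rw [dist_eq_norm, dist_eq_norm, rot_sub, NNReal.coe_one, one_mul]
  exact norm_le_of_dominated fun k => (norm_rot_apply ω _ k).le

theorem tendsto_ballCoeff {F : C₀(ℕ, ℂ) → X} {C : ℝ} (hF : ContinuousOn F (ball 0 1))
    (hC : ∀ z ∈ ball 0 1, ‖F z‖ ≤ C) {y : ℕ → C₀(ℕ, ℂ)} {z : C₀(ℕ, ℂ)}
    (hy : ∀ m, y m ∈ ball 0 1) (hz : z ∈ ball 0 1) (h : Tendsto y atTop (𝓝 z)) (α : ℕ →₀ ℤ) :
    Tendsto (fun m => ballCoeff F (y m) α) atTop (𝓝 (ballCoeff F z α)) := by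
  refine tendsto_integral_of_dominated_convergence (fun _ => C) (fun m => ?_)
    (integrable_const _) (fun m => ae_of_all _ fun ω => ?_) (ae_of_all _ fun ω => ?_)
  · exact ((continuous_coe_torusMonomial _).smul
      (continuous_comp_rot hF (hy m))).aestronglyMeasurable
  · rw [norm_smul, norm_torusMonomial, one_mul]
    exact hC _ (rot_mem_ball (hy m) ω)
  · refine Tendsto.const_smul ?_ _
    exact ((hF.continuousAt (isOpen_ball.mem_nhds (rot_mem_ball hz ω))).tendsto).comp
      (((continuous_rot_right ω).tendsto z).comp h)

theorem torusMonomial_mul (α : ℕ →₀ ℤ) (ω η : ℕ → Circle) :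
    torusMonomial α (ω * η) = torusMonomial α ω * torusMonomial α η := by
  simp [torusMonomial, mul_zpow, Finsupp.prod_mul]

theorem torusMonomial_mulSingle (α : ℕ →₀ ℤ) (k : ℕ) (u : Circle) :
    torusMonomial α (Pi.mulSingle k u) = u ^ α k := by
  classical
  rw [torusMonomial, Finsupp.prod]
  by_cases hk : k ∈ α.support
  · rw [Finset.prod_eq_single k (fun j _ hj => by rw [Pi.mulSingle_eq_of_ne hj, one_zpow])
      fun h => absurd hk h, Pi.mulSingle_eq_same]
  · rw [Finsupp.notMem_support_iff.1 hk, zpow_zero]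
    refine Finset.prod_eq_one fun j hj => ?_
    rw [Pi.mulSingle_eq_of_ne (ne_of_mem_of_not_mem hj hk), one_zpow]

theorem rot_mulSingle_mul (k : ℕ) (u : Circle) (ω : ℕ → Circle) (z : C₀(ℕ, ℂ)) :
    rot (Pi.mulSingle k u * ω) z = setCoord (rot ω z) k (ω k * z k * u) := by
  ext j
  rw [setCoord_apply, rot_apply]
  split_ifs with h
  · subst h
    rw [Pi.mul_apply, Pi.mulSingle_eq_same, Circle.coe_mul]
    ring
  · rw [Pi.mul_apply, Pi.mulSingle_eq_of_ne h, one_mul, rot_apply]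

/-- Haar measure is invariant under rotating the k-th coordinate by e^{it}. Averaging over t and
exchanging the integrals isolates a Fourier coefficient of the one-variable slice of F in that
coordinate. -/
theorem ballCoeff_eq_integral_circle [CompleteSpace X] {F : C₀(ℕ, ℂ) → X} {C : ℝ}
    (hF : ContinuousOn F (ball 0 1))
    (hC : ∀ z ∈ ball 0 1, ‖F z‖ ≤ C) {z : C₀(ℕ, ℂ)} (hz : z ∈ ball 0 1) (α : ℕ →₀ ℤ) (k : ℕ) :
    (2 * Real.pi : ℂ) • ballCoeff F z α = ∫ ω, (torusMonomial (-α) ω : ℂ) •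
      (∫ t in (0 : ℝ)..2 * Real.pi, Complex.exp (((-α k : ℤ) : ℂ) * t * Complex.I) •
        F (setCoord (rot ω z) k (ω k * z k * Complex.exp (t * Complex.I)))) ∂torusMeasure := by
  set f : (ℕ → Circle) → X := fun ω => (torusMonomial (-α) ω : ℂ) • F (rot ω z) with hf
  have hfc : Continuous f := (continuous_coe_torusMonomial _).smul (continuous_comp_rot hF hz)
  have hfC : ∀ ω, ‖f ω‖ ≤ C := fun ω => by
    rw [hf, norm_smul, norm_torusMonomial, one_mul]
    exact hC _ (rot_mem_ball hz ω)
  set u : ℝ → ℕ → Circle := fun t => Pi.mulSingle k (Circle.exp t) with hu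
  have huc : Continuous u := by
    refine continuous_pi fun j => ?_
    by_cases h : j = k
    · subst h
      simpa [hu] using Circle.exp.continuous
    · simp only [hu, Pi.mulSingle_eq_of_ne h]
      exact continuous_const
  have h1 : (2 * Real.pi : ℂ) • ballCoeff F z α =
      ∫ t in (0 : ℝ)..2 * Real.pi, ∫ ω, f (u t * ω) ∂torusMeasure := by
    simp only [integral_mul_left_eq_self]
    rw [intervalIntegral.integral_const, sub_zero, ← Complex.coe_smul]
    push_cast
    rfl
  have hpi : (0 : ℝ) ≤ 2 * Real.pi := Real.two_pi_pos.le
  rw [h1, intervalIntegral.integral_of_le hpi, integral_integral_swap]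
  · refine integral_congr_ae (ae_of_all _ fun ω => ?_)
    simp only
    rw [← intervalIntegral.integral_of_le hpi, ← intervalIntegral.integral_smul]
    refine intervalIntegral.integral_congr fun t _ => ?_
    simp only [hf, hu]
    rw [torusMonomial_mul, torusMonomial_mulSingle, rot_mulSingle_mul, smul_smul,
      Circle.coe_mul, mul_comm]
    congr 2
    · rw [Circle.coe_zpow, Circle.coe_exp, ← Complex.exp_int_mul]
      congr 1
      simp
      ring
  -- Fubini applies because the integrand is continuous and bounded by C on a space of finite
  -- measure.
  · refine Integrable.of_bound (C := C) ?_ (ae_of_all _ fun p => hfC _)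
    refine Continuous.aestronglyMeasurable ?_
    exact hfc.comp ((huc.comp continuous_fst).mul continuous_snd)

variable {F : C₀(ℕ, ℂ) → X} {C : ℝ}

theorem coord_mul_mem_ball {z : C₀(ℕ, ℂ)} (hz : z ∈ ball 0 1) (ω : ℕ → Circle) (k : ℕ) :
    (ω k : ℂ) * z k ∈ ball (0 : ℂ) 1 := by
  rw [mem_ball_zero_iff, norm_mul, Circle.norm_coe, one_mul]
  exact norm_apply_lt_one hz k

theorem differentiableOn_setCoord (hF : DifferentiableOn ℂ F (ball 0 1)) {z : C₀(ℕ, ℂ)}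
    (hz : z ∈ ball 0 1) (k : ℕ) : DifferentiableOn ℂ (fun ζ => F (setCoord z k ζ)) (ball 0 1) :=
  hF.comp (differentiable_setCoord z k).differentiableOn fun _ hζ => setCoord_mem_ball hz k hζ

variable [CompleteSpace X]

theorem ballCoeff_eq_zero (hF : DifferentiableOn ℂ F (ball 0 1))
    (hC : ∀ z ∈ ball 0 1, ‖F z‖ ≤ C) {z : C₀(ℕ, ℂ)} (hz : z ∈ ball 0 1) {α : ℕ →₀ ℤ}
    (hα : ∃ k, α k < 0) : ballCoeff F z α = 0 := by
  obtain ⟨k, hk⟩ := hα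
  have h := ballCoeff_eq_integral_circle hF.continuousOn hC hz α k
  have h0 : ∀ ω : ℕ → Circle, ∫ t in (0 : ℝ)..2 * Real.pi,
      Complex.exp (((-α k : ℤ) : ℂ) * t * Complex.I) •
        F (setCoord (rot ω z) k (ω k * z k * Complex.exp (t * Complex.I))) = 0 := fun ω => by
    obtain ⟨c, hc⟩ := exists_circle_coeff (differentiableOn_setCoord hF (rot_mem_ball hz ω) k)
    rw [hc _ (coord_mul_mem_ball hz ω k), if_neg (not_le.2 hk)]
  simp only [h0, smul_zero, integral_zero] at h
  exact (smul_eq_zero.1 h).resolve_left (by simp [Real.pi_ne_zero])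

/-- The slice through `rot ω z` in direction k does not see the k-th coordinate of z, which enters
only as the radius of the circle and hence through its power. Cross-multiplication keeps the
identity meaningful when that coordinate is 0. -/
theorem pow_smul_ballCoeff (hF : DifferentiableOn ℂ F (ball 0 1))
    (hC : ∀ z ∈ ball 0 1, ‖F z‖ ≤ C) {z : C₀(ℕ, ℂ)} (hz : z ∈ ball 0 1) (α : ℕ →₀ ℕ) (k : ℕ)
    {ζ : ℂ} (hζ : ζ ∈ ball 0 1) :
    ζ ^ α k • ballCoeff F z (toIntIndex α) =
      z k ^ α k • ballCoeff F (setCoord z k ζ) (toIntIndex α) := by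
  have hz' := setCoord_mem_ball hz k hζ
  have h := ballCoeff_eq_integral_circle hF.continuousOn hC hz (toIntIndex α) k
  have h' := ballCoeff_eq_integral_circle hF.continuousOn hC hz' (toIntIndex α) k
  have hpi : (2 * Real.pi : ℂ) ≠ 0 := by simp [Real.pi_ne_zero]
  refine smul_right_injective X hpi ?_
  simp only
  rw [smul_comm, h, smul_comm, h', ← integral_smul, ← integral_smul]
  refine integral_congr_ae (ae_of_all _ fun ω => ?_)
  simp only
  rw [smul_comm, smul_comm (z k ^ α k)]
  congr 1
  obtain ⟨c, hc⟩ := exists_circle_coeff (differentiableOn_setCoord hF (rot_mem_ball hz ω) k)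
  -- Both inner integrals run over the same slice, since the k-th coordinate is overwritten in
  -- either case; so one sequence c computes both.
  have e : ∀ ξ, setCoord (rot ω (setCoord z k ζ)) k ξ = setCoord (rot ω z) k ξ := fun ξ => by
    ext j
    simp only [setCoord_apply, rot_apply]
    split_ifs <;> rfl
  have hk : (toIntIndex α) k = α k := rfl
  simp only [e]
  rw [hc _ (coord_mul_mem_ball hz ω k), hc _ (coord_mul_mem_ball hz' ω k), hk,
    if_pos (Int.natCast_nonneg _), if_pos (Int.natCast_nonneg _), Int.toNat_natCast,
    setCoord_apply, if_pos rfl]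
  simp only [smul_smul, mul_pow]
  congr 1
  ring

/-- The null sequence whose first `m` terms are those of `z'` and the others those of `z`. -/
noncomputable def mix (z z' : C₀(ℕ, ℂ)) : ℕ → C₀(ℕ, ℂ)
  | 0 => z
  | m + 1 => setCoord (mix z z' m) m (z' m)

theorem mix_apply (z z' : C₀(ℕ, ℂ)) (m k : ℕ) : mix z z' m k = if k < m then z' k else z k := by
  induction m with
  | zero => simp [mix]
  | succ m ih =>
    rw [mix, setCoord_apply, ih]
    rcases lt_trichotomy k m with h | h | h
    · rw [if_neg h.ne, if_pos h, if_pos (by omega)]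
    · subst h
      simp
    · rw [if_neg h.ne', if_neg (by omega), if_neg (by omega)]

theorem mix_mem_ball {z z' : C₀(ℕ, ℂ)} (hz : z ∈ ball 0 1) (hz' : z' ∈ ball 0 1) (m : ℕ) :
    mix z z' m ∈ ball 0 1 := by
  induction m with
  | zero => exact hz
  | succ m ih => exact setCoord_mem_ball ih m (mem_ball_zero_iff.2 (norm_apply_lt_one hz' m))

theorem tendsto_mix (z z' : C₀(ℕ, ℂ)) : Tendsto (mix z z') atTop (𝓝 z') := by
  have h : mix z z' = fun m => trunc m z' + (z - trunc m z) := by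
    funext m
    ext k
    rw [mix_apply, ZeroAtInftyContinuousMap.add_apply, ZeroAtInftyContinuousMap.sub_apply,
      trunc_apply, trunc_apply]
    split_ifs <;> simp
  rw [h]
  simpa using (tendsto_trunc z').add ((tendsto_const_nhds (x := z)).sub (tendsto_trunc z))

theorem prod_smul_ballCoeff (hF : DifferentiableOn ℂ F (ball 0 1))
    (hC : ∀ z ∈ ball 0 1, ‖F z‖ ≤ C) {z z' : C₀(ℕ, ℂ)} (hz : z ∈ ball 0 1) (hz' : z' ∈ ball 0 1)
    (α : ℕ →₀ ℕ) (m : ℕ) :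
    (∏ k ∈ Finset.range m, z' k ^ α k) • ballCoeff F z (toIntIndex α) =
      (∏ k ∈ Finset.range m, z k ^ α k) • ballCoeff F (mix z z' m) (toIntIndex α) := by
  induction m with
  | zero => simp [mix]
  | succ m ih =>
    have h := pow_smul_ballCoeff hF hC (mix_mem_ball hz hz' m) α m
      (mem_ball_zero_iff.2 (norm_apply_lt_one hz' m))
    rw [mix_apply, if_neg (lt_irrefl m)] at h
    rw [Finset.prod_range_succ, mul_comm, mul_smul, ih, smul_comm, h, smul_smul,
      Finset.prod_range_succ]
    rfl

/-- Coordinates are exchanged one at a time along `mix z z'`. Beyond the support of α the factors no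
longer change, and `mix z z' m` tends to z' in c₀, so continuity of the Fourier coefficient
completes the exchange of all coordinates. -/
theorem monomial_smul_ballCoeff (hF : DifferentiableOn ℂ F (ball 0 1))
    (hC : ∀ z ∈ ball 0 1, ‖F z‖ ≤ C) {z z' : C₀(ℕ, ℂ)} (hz : z ∈ ball 0 1) (hz' : z' ∈ ball 0 1)
    (α : ℕ →₀ ℕ) :
    monomial α z' • ballCoeff F z (toIntIndex α) =
      monomial α z • ballCoeff F z' (toIntIndex α) := by
  obtain ⟨M, hM⟩ : ∃ M, α.support ⊆ Finset.range M := α.support.exists_nat_subset_range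
  have e : ∀ (w : C₀(ℕ, ℂ)) (m : ℕ), M ≤ m →
      ∏ k ∈ Finset.range m, w k ^ α k = monomial α w := fun w m hm =>
    (Finsupp.prod_of_support_subset _ (hM.trans (Finset.range_subset_range.2 hm)) _
      fun k _ => pow_zero _).symm
  have h := (tendsto_ballCoeff hF.continuousOn hC (mix_mem_ball hz hz') hz' (tendsto_mix z z')
    (toIntIndex α)).const_smul (monomial α z)
  refine tendsto_nhds_unique (tendsto_const_nhds.congr' ?_) h
  filter_upwards [Filter.eventually_ge_atTop M] with m hm
  rw [← e z' m hm, ← e z m hm]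
  exact prod_smul_ballCoeff hF hC hz hz' α m

end TorusFourier

/-! ### Absolutely convergent series of monomials on the torus -/

section Series

variable {Y : Type*} [NormedAddCommGroup Y] [NormedSpace ℂ Y]

theorem toIntIndex_apply (α : ℕ →₀ ℕ) (k : ℕ) : toIntIndex α k = α k := rfl

theorem toIntIndex_injective : Function.Injective toIntIndex := fun α β h => by
  ext k
  have := DFunLike.congr_fun h k
  simpa [toIntIndex_apply] using this

theorem toIntIndex_add (α β : ℕ →₀ ℕ) : toIntIndex (α + β) = toIntIndex α + toIntIndex β := by
  ext k
  simp [toIntIndex_apply]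

theorem exists_toIntIndex_eq {β : ℕ →₀ ℤ} (h : ∀ k, 0 ≤ β k) : ∃ α, toIntIndex α = β :=
  ⟨β.mapRange Int.toNat rfl, by ext k; simp [toIntIndex, h k]⟩

/-- If γ_k ≠ 0, rotating the k-th coordinate by e^{iπ/γ_k} multiplies the monomial by -1, so by
invariance the integral equals its own negative. -/
theorem integral_torusMonomial (γ : ℕ →₀ ℤ) :
    ∫ ω, (torusMonomial γ ω : ℂ) ∂torusMeasure = if γ = 0 then 1 else 0 := by
  split_ifs with h
  · subst h
    simp [torusMonomial_zero]
  · obtain ⟨k, hk⟩ := Finsupp.ne_iff.1 h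
    rw [Finsupp.zero_apply] at hk
    have h1 := integral_mul_left_eq_self (μ := torusMeasure)
      (fun ω => (torusMonomial γ ω : ℂ)) (Pi.mulSingle k (Circle.exp (Real.pi / γ k)))
    have h2 : Circle.exp (Real.pi / γ k) ^ γ k = Circle.exp Real.pi := by
      apply Circle.ext
      rw [Circle.coe_zpow, Circle.coe_exp, Circle.coe_exp, ← Complex.exp_int_mul]
      congr 1
      have : (γ k : ℂ) ≠ 0 := Int.cast_ne_zero.2 hk
      push_cast
      field_simp
    simp only [torusMonomial_mul, torusMonomial_mulSingle, h2, Circle.coe_mul, Circle.coe_exp,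
      Complex.exp_pi_mul_I] at h1
    rw [integral_const_mul, neg_one_mul] at h1
    exact self_eq_neg.1 h1.symm

theorem integral_torusMonomial_smul_tsum [CompleteSpace Y] {b : (ℕ →₀ ℕ) → Y}
    (hb : Summable fun α => ‖b α‖) (β : ℕ →₀ ℤ) :
    HasSum (fun α => (if toIntIndex α = β then (1 : ℂ) else 0) • b α)
      (∫ ω, (torusMonomial (-β) ω : ℂ) •
        ∑' α, (torusMonomial (toIntIndex α) ω : ℂ) • b α ∂torusMeasure) := by
  have hint : ∀ α, Integrable (fun ω => (torusMonomial (toIntIndex α - β) ω : ℂ) • b α)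
      torusMeasure := fun α => by
    refine Integrable.of_bound (C := ‖b α‖) ?_ (ae_of_all _ fun ω => ?_)
    · exact ((continuous_coe_torusMonomial _).smul continuous_const).aestronglyMeasurable
    · rw [norm_smul, norm_torusMonomial, one_mul]
  have h := hasSum_integral_of_summable_integral_norm hint (by
    simpa only [norm_smul, norm_torusMonomial, one_mul, integral_const, probReal_univ, one_smul]
      using hb)
  have e : ∀ ω, ∑' α, (torusMonomial (toIntIndex α - β) ω : ℂ) • b α =
      (torusMonomial (-β) ω : ℂ) • ∑' α, (torusMonomial (toIntIndex α) ω : ℂ) • b α := fun ω => by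
    rw [← tsum_const_smul'']
    refine tsum_congr fun α => ?_
    rw [smul_smul, sub_eq_add_neg, torusMonomial_add, Circle.coe_mul, mul_comm]
  simp only [e, integral_smul_const, integral_torusMonomial, sub_eq_zero] at h
  exact h

theorem continuous_tsum_torusMonomial [CompleteSpace Y] {b : (ℕ →₀ ℕ) → Y}
    (hb : Summable fun α => ‖b α‖) :
    Continuous fun ω => ∑' α, (torusMonomial (toIntIndex α) ω : ℂ) • b α := by
  refine continuous_tsum (fun α => (continuous_coe_torusMonomial _).smul continuous_const) hb
    fun α ω => ?_
  rw [norm_smul, norm_torusMonomial, one_mul]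

theorem summable_torusMonomial_smul [CompleteSpace Y] {b : (ℕ →₀ ℕ) → Y}
    (hb : Summable fun α => ‖b α‖) (ω : ℕ → Circle) :
    Summable fun α => (torusMonomial (toIntIndex α) ω : ℂ) • b α :=
  Summable.of_norm (by simpa only [norm_smul, norm_torusMonomial, one_mul] using hb)

omit [NormedSpace ℂ Y] in
theorem memLp_of_continuous {f : (ℕ → Circle) → Y} (hf : Continuous f) :
    MemLp f ∞ torusMeasure := by
  obtain ⟨C, hC⟩ := isCompact_univ.exists_bound_of_continuousOn hf.continuousOn
  exact memLp_top_of_bound hf.aestronglyMeasurable C (ae_of_all _ fun ω => hC ω trivial)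

theorem torusCoeff_toLp {f : (ℕ → Circle) → Y} (hf : MemLp f ∞ torusMeasure) (α : ℕ →₀ ℤ) :
    torusCoeff α hf.toLp = ∫ ω, (torusMonomial (-α) ω : ℂ) • f ω ∂torusMeasure :=
  integral_congr_ae (hf.coeFn_toLp.mono fun ω hω => by simp only [hω])

/-- The functions agree almost everywhere by uniqueness of Fourier coefficients. Being continuous,
they agree everywhere, as Haar measure charges every nonempty open set. -/
theorem eq_of_torusCoeff_eq [CompleteSpace Y] {f g : (ℕ → Circle) → Y} (hf : Continuous f)
    (hg : Continuous g) (h : ∀ α, ∫ ω, (torusMonomial (-α) ω : ℂ) • f ω ∂torusMeasure =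
      ∫ ω, (torusMonomial (-α) ω : ℂ) • g ω ∂torusMeasure) : f = g := by
  have h0 := eq_zero_of_torusCoeff
    (f := (memLp_of_continuous hf).toLp - (memLp_of_continuous hg).toLp) fun α => by
      rw [map_sub, torusCoeff_toLp, torusCoeff_toLp, h, sub_self]
  rw [sub_eq_zero, MemLp.toLp_eq_toLp_iff] at h0
  exact (hf.ae_eq_iff_eq torusMeasure hg).1 h0

end Series

/-! ### Monomial expansions -/

section Expansion

open Metric

theorem one_re_pos : 0 < (1 : ℂ).re := by simp

theorem primePow_cpow (α : ℕ →₀ ℕ) (s : ℂ) :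
    ((primePow α : ℕ) : ℂ) ^ s = α.prod fun k e => ((prime k : ℂ) ^ s) ^ e := by
  classical
  have hpow : ∀ (p e : ℕ), ((p ^ e : ℕ) : ℂ) ^ s = ((p : ℂ) ^ s) ^ e := fun p e => by
    induction e with
    | zero => simp
    | succ e ih => rw [pow_succ, Nat.cast_mul, Complex.natCast_mul_natCast_cpow, ih, pow_succ]
  change ((∏ k ∈ α.support, prime k ^ α k : ℕ) : ℂ) ^ s = ∏ k ∈ α.support, _
  induction α.support using Finset.induction_on with
  | empty => simp
  | insert k t hk ih =>
    rw [Finset.prod_insert hk, Finset.prod_insert hk, Nat.cast_mul,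
      Complex.natCast_mul_natCast_cpow, ih, hpow]

theorem monomial_primeSeq (α : ℕ →₀ ℕ) (s : ℂ) (hs : 0 < s.re) :
    monomial α (primeSeq s hs) = ((primePow α : ℕ) : ℂ) ^ (-s) :=
  (primePow_cpow α (-s)).symm

theorem monomial_primeSeq_ne_zero (α : ℕ →₀ ℕ) (s : ℂ) (hs : 0 < s.re) :
    monomial α (primeSeq s hs) ≠ 0 := by
  rw [monomial_primeSeq]
  have : ((primePow α : ℕ) : ℂ) ≠ 0 := Nat.cast_ne_zero.2 (primePow α).ne_zero
  simp [Complex.cpow_eq_zero_iff, this]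

variable {X : Type*} [NormedAddCommGroup X] [NormedSpace ℂ X]

/-- The monomial coefficients of a bounded holomorphic function on the unit ball of `c₀`. -/
noncomputable def monomialCoeff (F : C₀(ℕ, ℂ) → X) (α : ℕ →₀ ℕ) : X :=
  (monomial α (primeSeq 1 one_re_pos))⁻¹ • ballCoeff F (primeSeq 1 one_re_pos) (toIntIndex α)

/-- Let ε tend to 0: n^{-ε} tends to 1. -/
theorem norm_le_of_norm_cpow_smul_le {a : X} {C : ℝ} (n : ℕ+)
    (h : ∀ ε : ℝ, 0 < ε → ‖((n : ℕ) : ℂ) ^ (-(ε : ℂ)) • a‖ ≤ C) : ‖a‖ ≤ C := by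
  have hn : ((n : ℕ) : ℂ) ≠ 0 := Nat.cast_ne_zero.2 n.ne_zero
  have h1 : Tendsto (fun ε : ℝ => ‖((n : ℕ) : ℂ) ^ (-(ε : ℂ)) • a‖) (𝓝[>] 0)
      (𝓝 ‖((n : ℕ) : ℂ) ^ (-((0 : ℝ) : ℂ)) • a‖) := by
    have : Continuous fun ε : ℝ => ‖((n : ℕ) : ℂ) ^ (-(ε : ℂ)) • a‖ := by
      refine (Continuous.smul ?_ continuous_const).norm
      exact (Complex.continuous_ofReal.neg).const_cpow (Or.inl hn)
    exact (this.tendsto 0).mono_left nhdsWithin_le_nhds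
  rw [Complex.ofReal_zero, neg_zero, Complex.cpow_zero, one_smul] at h1
  exact le_of_tendsto h1 (eventually_mem_nhdsWithin.mono fun ε hε => h ε hε)

variable [CompleteSpace X] {F : C₀(ℕ, ℂ) → X} {C : ℝ}

/-- The cross-multiplied identity is applied with the reference point 𝔭^{-1}, at which no monomial
vanishes, so division is allowed there while z is arbitrary. -/
theorem ballCoeff_eq (hF : DifferentiableOn ℂ F (ball 0 1)) (hC : ∀ z ∈ ball 0 1, ‖F z‖ ≤ C)
    {z : C₀(ℕ, ℂ)} (hz : z ∈ ball 0 1) (α : ℕ →₀ ℕ) :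
    ballCoeff F z (toIntIndex α) = monomial α z • monomialCoeff F α := by
  have h := monomial_smul_ballCoeff hF hC hz (primeSeq_mem 1 one_re_pos) α
  rw [monomialCoeff, smul_comm, ← h, smul_smul,
    inv_mul_cancel₀ (monomial_primeSeq_ne_zero α 1 one_re_pos), one_smul]

/-- At 𝔭^{-ε} the Fourier coefficient is n^{-ε} c_α and is bounded by C for every ε > 0. -/
theorem norm_monomialCoeff_le (hF : DifferentiableOn ℂ F (ball 0 1))
    (hC : ∀ z ∈ ball 0 1, ‖F z‖ ≤ C) (α : ℕ →₀ ℕ) : ‖monomialCoeff F α‖ ≤ C := by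
  refine norm_le_of_norm_cpow_smul_le (primePow α) fun ε hε => ?_
  rw [← monomial_primeSeq α ε (by simpa using hε), ← ballCoeff_eq hF hC (primeSeq_mem _ _)]
  exact norm_ballCoeff_le hC (primeSeq_mem _ _) _

omit [CompleteSpace X] in
theorem summable_norm_monomial_smul {c : (ℕ →₀ ℕ) → X} (hc : ∀ α, ‖c α‖ ≤ C) {m : ℕ}
    {z : ℕ → ℂ} (hz : ∀ k, m ≤ k → z k = 0) (h1 : ∀ k, ‖z k‖ < 1) :
    Summable fun α => ‖monomial α z • c α‖ := by
  refine Summable.of_nonneg_of_le (fun _ => norm_nonneg _) (fun α => ?_)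
    ((summable_norm_monomial hz h1).mul_right C)
  rw [norm_smul]
  exact mul_le_mul_of_nonneg_left (hc α) (norm_nonneg _)

/-- A bounded holomorphic function is the sum of its monomial series at finitely supported
points. -/
theorem hasSum_monomialCoeff (hF : DifferentiableOn ℂ F (ball 0 1))
    (hC : ∀ z ∈ ball 0 1, ‖F z‖ ≤ C) {m : ℕ} {z : C₀(ℕ, ℂ)} (hz : z ∈ ball 0 1)
    (hm : ∀ k, m ≤ k → z k = 0) :
    HasSum (fun α => monomial α z • monomialCoeff F α) (F z) := by
  have hb := summable_norm_monomial_smul (norm_monomialCoeff_le hF hC) hm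
    (norm_apply_lt_one hz)
  -- Both sides are extended to continuous functions on the torus, F(ωz) and the monomial series at
  -- ωz. These have equal Fourier coefficients; the claim is their equality at ω = 1.
  have h := eq_of_torusCoeff_eq (continuous_comp_rot hF.continuousOn hz)
    (continuous_tsum_torusMonomial hb) fun β => ?_
  · have h1 := congrFun h 1
    simp only [rot_one] at h1
    rw [h1]
    convert (summable_torusMonomial_smul hb 1).hasSum using 2 with α
    simp [torusMonomial]
  · refine ((integral_torusMonomial_smul_tsum hb β).unique ?_).symm
    change HasSum _ (ballCoeff F z β)
    by_cases hβ : ∃ k, β k < 0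
    · rw [ballCoeff_eq_zero hF hC hz hβ]
      convert hasSum_zero using 1
      ext α
      obtain ⟨k, hk⟩ := hβ
      rw [if_neg, zero_smul]
      rintro rfl
      rw [toIntIndex_apply] at hk
      omega
    · push Not at hβ
      obtain ⟨α, rfl⟩ := exists_toIntIndex_eq hβ
      rw [ballCoeff_eq hF hC hz]
      convert hasSum_single α fun α' hα' => ?_ using 1
      · rw [if_pos rfl, one_smul]
      · rw [if_neg fun h => hα' (toIntIndex_injective h), zero_smul]

/-- The coefficients of a monomial expansion are determined by the function. -/
theorem monomialCoeff_eq_of_hasSum {c : (ℕ →₀ ℕ) → X} (hF : DifferentiableOn ℂ F (ball 0 1))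
    (hC : ∀ z ∈ ball 0 1, ‖F z‖ ≤ C) {C' : ℝ} (hc : ∀ α, ‖c α‖ ≤ C')
    (h : ∀ (m : ℕ) (z : C₀(ℕ, ℂ)), z ∈ ball 0 1 → (∀ k, m ≤ k → z k = 0) →
      HasSum (fun α => monomial α z • c α) (F z)) : monomialCoeff F = c := by
  funext α
  obtain ⟨m, hm⟩ : ∃ m, α.support ⊆ Finset.range m := α.support.exists_nat_subset_range
  -- A finitely supported point at which z^α is nonzero, because m exceeds every index in the
  -- support of α.
  set z := trunc m (primeSeq 1 one_re_pos) with hzdef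
  have hz : z ∈ ball 0 1 := trunc_mem_ball (primeSeq_mem _ _) m
  have hz0 : ∀ k, m ≤ k → z k = 0 := fun k hk => trunc_apply_eq_zero hk _
  have hb := summable_norm_monomial_smul hc hz0 (norm_apply_lt_one hz)
  have hne : monomial α z ≠ 0 := by
    have : monomial α z = monomial α (primeSeq 1 one_re_pos) :=
      Finset.prod_congr rfl fun k hk => by
        change z k ^ α k = _
        rw [hzdef, trunc_apply, if_pos (Finset.mem_range.1 (hm hk))]
    rw [this]
    exact monomial_primeSeq_ne_zero α 1 one_re_pos
  refine smul_right_injective X hne ?_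
  simp only
  rw [← ballCoeff_eq hF hC hz]
  have e : ∀ ω, F (rot ω z) = ∑' α, (torusMonomial (toIntIndex α) ω : ℂ) • monomial α z • c α :=
    fun ω => by
      rw [← (h m (rot ω z) (rot_mem_ball hz ω) fun k hk => by
        rw [rot_apply, hz0 k hk, mul_zero]).tsum_eq]
      exact tsum_congr fun α => by rw [monomial_rot, smul_smul]
  rw [ballCoeff]
  simp only [e]
  refine (integral_torusMonomial_smul_tsum hb (toIntIndex α)).unique ?_
  convert hasSum_single α fun α' hα' => ?_ using 1
  · rw [if_pos rfl, one_smul]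
  · rw [if_neg fun h => hα' (toIntIndex_injective h), zero_smul]

end Expansion

/-! ### Evaluation at interior points is bounded by the essential supremum on the torus -/

section Szego

open ComplexConjugate

/-- The (conjugate of the) Szegő kernel of the polydisc. -/
noncomputable def szego (u : ℕ → ℂ) (ω : ℕ → Circle) : ℂ :=
  ∑' γ, (torusMonomial (toIntIndex γ) ω : ℂ) • conj (monomial γ u)

variable {u : ℕ → ℂ} {m : ℕ}

theorem continuous_szego (hu : ∀ k, m ≤ k → u k = 0) (h1 : ∀ k, ‖u k‖ < 1) :
    Continuous (szego u) :=
  continuous_tsum_torusMonomial (by simpa using summable_norm_monomial hu h1)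

theorem hasSum_szego (hu : ∀ k, m ≤ k → u k = 0) (h1 : ∀ k, ‖u k‖ < 1) (ω : ℕ → Circle) :
    HasSum (fun γ => (torusMonomial (toIntIndex γ) ω : ℂ) * conj (monomial γ u)) (szego u ω) :=
  (summable_torusMonomial_smul (by simpa using summable_norm_monomial hu h1) ω).hasSum

theorem summable_norm_mul_monomial (hu : ∀ k, m ≤ k → u k = 0) (h1 : ∀ k, ‖u k‖ < 1) :
    Summable fun p : (ℕ →₀ ℕ) × (ℕ →₀ ℕ) => ‖monomial p.1 u * conj (monomial p.2 u)‖ := by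
  simp only [norm_mul, RCLike.norm_conj]
  exact (summable_norm_monomial hu h1).mul_of_nonneg (summable_norm_monomial hu h1)
    (fun _ => norm_nonneg _) fun _ => norm_nonneg _

theorem norm_sq_szego (hu : ∀ k, m ≤ k → u k = 0) (h1 : ∀ k, ‖u k‖ < 1) (ω : ℕ → Circle) :
    HasSum (fun p : (ℕ →₀ ℕ) × (ℕ →₀ ℕ) => (monomial p.1 u * conj (monomial p.2 u)) *
      (torusMonomial (-(toIntIndex p.1 - toIntIndex p.2)) ω : ℂ)) ((‖szego u ω‖ ^ 2 : ℝ) : ℂ) := by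
  have hK := hasSum_szego hu h1 ω
  have hK' := Complex.hasSum_conj'.2 hK
  have e : ∀ p : (ℕ →₀ ℕ) × (ℕ →₀ ℕ), (monomial p.1 u * conj (monomial p.2 u)) *
      (torusMonomial (-(toIntIndex p.1 - toIntIndex p.2)) ω : ℂ) =
      conj ((torusMonomial (toIntIndex p.1) ω : ℂ) * conj (monomial p.1 u)) *
        ((torusMonomial (toIntIndex p.2) ω : ℂ) * conj (monomial p.2 u)) := fun p => by
    rw [neg_sub, sub_eq_add_neg, torusMonomial_add, torusMonomial_neg, Circle.coe_mul,
      Circle.coe_inv_eq_conj, map_mul, Complex.conj_conj]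
    ring
  have hs : Summable fun p : (ℕ →₀ ℕ) × (ℕ →₀ ℕ) => (monomial p.1 u * conj (monomial p.2 u)) *
      (torusMonomial (-(toIntIndex p.1 - toIntIndex p.2)) ω : ℂ) := by
    refine Summable.of_norm ?_
    simpa only [norm_mul, norm_torusMonomial, mul_one] using summable_norm_mul_monomial hu h1
  have h2 := hs.hasSum
  simp only [e] at h2 ⊢
  have h3 := hK'.mul_eq hK h2
  rw [← h3, mul_comm, Complex.mul_conj, Complex.normSq_eq_norm_sq] at h2
  exact h2

variable {Y : Type*} [NormedAddCommGroup Y] [NormedSpace ℂ Y]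

/-- The squared kernel expands into terms u^β conj(u^γ) ω^{-(β-γ)}, so the integral is a double sum
of u^β conj(u^γ) f̂(β-γ). Only β ≥ γ survives; with β = α + γ the term becomes |u^γ|² u^α f̂(α), and
the sum factors. -/
theorem integral_norm_sq_szego_smul [CompleteSpace Y] (hu : ∀ k, m ≤ k → u k = 0)
    (h1 : ∀ k, ‖u k‖ < 1) {f : (ℕ → Circle) → Y} (hf : Integrable f torusMeasure)
    (h0 : ∀ β : ℕ →₀ ℤ, (∃ k, β k < 0) →
      ∫ ω, (torusMonomial (-β) ω : ℂ) • f ω ∂torusMeasure = 0) :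
    ∫ ω, ((‖szego u ω‖ ^ 2 : ℝ) : ℂ) • f ω ∂torusMeasure =
      ((∑' γ, ‖monomial γ u‖ ^ 2 : ℝ) : ℂ) • ∑' α, monomial α u •
        ∫ ω, (torusMonomial (-toIntIndex α) ω : ℂ) • f ω ∂torusMeasure := by
  set fc : (ℕ →₀ ℤ) → Y := fun β => ∫ ω, (torusMonomial (-β) ω : ℂ) • f ω ∂torusMeasure with hfc
  set K : ℝ := ∫ ω, ‖f ω‖ ∂torusMeasure with hK
  have hbd : ∀ β, ‖fc β‖ ≤ K := fun β => by
    refine (norm_integral_le_integral_norm _).trans_eq ?_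
    simp only [norm_smul, norm_torusMonomial, one_mul, hK]
  set a : (ℕ →₀ ℕ) × (ℕ →₀ ℕ) → ℂ := fun p => monomial p.1 u * conj (monomial p.2 u) with ha
  have hsa : Summable fun p => ‖a p‖ := summable_norm_mul_monomial hu h1
  have hint : ∀ p, Integrable (fun ω => (a p *
      (torusMonomial (-(toIntIndex p.1 - toIntIndex p.2)) ω : ℂ)) • f ω) torusMeasure := fun p => by
    refine hf.bdd_smul ‖a p‖ (continuous_const.mul
      (continuous_coe_torusMonomial _)).aestronglyMeasurable (ae_of_all _ fun ω => ?_)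
    rw [norm_mul, norm_torusMonomial, mul_one]
  have hL := hasSum_integral_of_summable_integral_norm hint (by
    simp only [norm_smul, norm_mul, norm_torusMonomial, mul_one, integral_const_mul]
    simpa only [norm_mul, ha] using hsa.mul_right K)
  have e1 : ∀ ω, ∑' p : (ℕ →₀ ℕ) × (ℕ →₀ ℕ), (a p *
      (torusMonomial (-(toIntIndex p.1 - toIntIndex p.2)) ω : ℂ)) • f ω =
      ((‖szego u ω‖ ^ 2 : ℝ) : ℂ) • f ω := fun ω =>
    ((norm_sq_szego hu h1 ω).smul_const (f ω)).tsum_eq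
  have e2 : ∀ p : (ℕ →₀ ℕ) × (ℕ →₀ ℕ), ∫ ω, (a p *
      (torusMonomial (-(toIntIndex p.1 - toIntIndex p.2)) ω : ℂ)) • f ω ∂torusMeasure =
      a p • fc (toIntIndex p.1 - toIntIndex p.2) := fun p => by
    simp only [mul_smul]
    rw [integral_smul]
  simp only [e1, e2] at hL
  -- The substitution (γ, α) ↦ (α + γ, γ). Pairs outside its range have β - γ with a negative entry,
  -- where f̂ vanishes.
  have hinj : Function.Injective fun p : (ℕ →₀ ℕ) × (ℕ →₀ ℕ) => (p.2 + p.1, p.1) := by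
    rintro ⟨γ, α⟩ ⟨γ', α'⟩ h
    simp only [Prod.mk.injEq] at h
    obtain ⟨h2, rfl⟩ := h
    rw [add_right_cancel h2]
  rw [← hinj.hasSum_iff] at hL
  · have hsq : Summable fun γ => ‖monomial γ u‖ ^ 2 := by
      refine Summable.of_nonneg_of_le (fun _ => by positivity) (fun γ => ?_)
        (summable_norm_monomial hu h1)
      exact pow_le_of_le_one (norm_nonneg _) (norm_monomial_le_one (fun k => (h1 k).le) γ)
        two_ne_zero
    have hR : Summable fun α => monomial α u • fc (toIntIndex α) :=
      (summable_norm_monomial_smul (fun α => hbd (toIntIndex α)) hu h1).of_norm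
    refine (((Complex.hasSum_ofReal.2 hsq.hasSum).smul_eq hR.hasSum ?_)).symm
    convert hL using 2 with p
    simp only [Function.comp_apply, ha, toIntIndex_add, add_sub_cancel_right, monomial_add]
    rw [smul_smul, mul_assoc, Complex.mul_conj, Complex.normSq_eq_norm_sq, mul_comm]
  · rintro ⟨β, γ⟩ hp
    have : ¬ γ ≤ β := fun h => hp ⟨(γ, β - γ), by simp [tsub_add_cancel_of_le h]⟩
    rw [Finsupp.le_def] at this
    push Not at this
    obtain ⟨k, hk⟩ := this
    have hz : fc (toIntIndex β - toIntIndex γ) = 0 := h0 _ ⟨k, by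
      rw [Finsupp.sub_apply, toIntIndex_apply, toIntIndex_apply]
      omega⟩
    simp only [hz, smul_zero]

/-- The reproducing identity for the constant function 1, whose only nonzero Fourier coefficient is
at 0. -/
theorem integral_norm_sq_szego (hu : ∀ k, m ≤ k → u k = 0) (h1 : ∀ k, ‖u k‖ < 1) :
    ∫ ω, ‖szego u ω‖ ^ 2 ∂torusMeasure = ∑' γ, ‖monomial γ u‖ ^ 2 := by
  have e : ∀ β : ℕ →₀ ℤ, ∫ ω, (torusMonomial (-β) ω : ℂ) • (1 : ℂ) ∂torusMeasure =
      if β = 0 then 1 else 0 := fun β => by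
    simp only [smul_eq_mul, mul_one, integral_torusMonomial, neg_eq_zero]
  have h := integral_norm_sq_szego_smul hu h1 (integrable_const (1 : ℂ)) fun β hβ => by
    obtain ⟨k, hk⟩ := hβ
    rw [e, if_neg]
    rintro rfl
    simp at hk
  have e2 : ∀ α : ℕ →₀ ℕ, toIntIndex α = 0 ↔ α = 0 := fun α => by
    rw [← toIntIndex_injective.eq_iff (b := 0)]
    exact Iff.of_eq (congrArg _ (by ext k; rfl))
  simp only [e, e2] at h
  have e3 : ∑' α : ℕ →₀ ℕ, monomial α u • (if α = 0 then (1 : ℂ) else 0) = 1 := by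
    rw [tsum_eq_single 0 fun α hα => by rw [if_neg hα, smul_zero], if_pos rfl, monomial_zero,
      smul_eq_mul, one_mul]
  rw [e3] at h
  simp only [smul_eq_mul, mul_one] at h
  rw [integral_complex_ofReal] at h
  exact_mod_cast h

/-- Dividing by A makes the squared kernel a probability density that reproduces the value at u, so
this value is a mean of f. Vanishing of the coefficients with a negative entry is what makes it
reproducing. -/
theorem norm_tsum_monomial_smul_le [CompleteSpace Y] (hu : ∀ k, m ≤ k → u k = 0)
    (h1 : ∀ k, ‖u k‖ < 1) {f : (ℕ → Circle) → Y} (hf : Integrable f torusMeasure)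
    (h0 : ∀ β : ℕ →₀ ℤ, (∃ k, β k < 0) →
      ∫ ω, (torusMonomial (-β) ω : ℂ) • f ω ∂torusMeasure = 0)
    {C : ℝ} (hC : ∀ᵐ ω ∂torusMeasure, ‖f ω‖ ≤ C) :
    ‖∑' α, monomial α u • ∫ ω, (torusMonomial (-toIntIndex α) ω : ℂ) • f ω ∂torusMeasure‖
      ≤ C := by
  have h := integral_norm_sq_szego_smul hu h1 hf h0
  set A : ℝ := ∑' γ, ‖monomial γ u‖ ^ 2 with hA
  have hsq : Summable fun γ => ‖monomial γ u‖ ^ 2 := by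
    refine Summable.of_nonneg_of_le (fun _ => by positivity) (fun γ => ?_)
      (summable_norm_monomial hu h1)
    exact pow_le_of_le_one (norm_nonneg _) (norm_monomial_le_one (fun k => (h1 k).le) γ)
      two_ne_zero
  have hA1 : 0 < A := by
    refine lt_of_lt_of_le one_pos ?_
    have := hsq.le_tsum 0 fun _ _ => by positivity
    simpa [monomial_zero] using this
  have hc : Continuous fun ω => ‖szego u ω‖ ^ 2 := (continuous_szego hu h1).norm.pow 2
  have h2 : ‖∫ ω, ((‖szego u ω‖ ^ 2 : ℝ) : ℂ) • f ω ∂torusMeasure‖ ≤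
      ∫ ω, ‖szego u ω‖ ^ 2 * C ∂torusMeasure := by
    refine norm_integral_le_of_norm_le ?_ (hC.mono fun ω hω => ?_)
    · exact ((memLp_of_continuous hc).integrable le_top).mul_const C
    · rw [norm_smul, Complex.norm_real, Real.norm_of_nonneg (by positivity)]
      gcongr
  rw [h, integral_mul_const, integral_norm_sq_szego hu h1, norm_smul, Complex.norm_real,
    Real.norm_of_nonneg hA1.le] at h2
  exact le_of_mul_le_mul_left h2 hA1

end Szego

/-! ### The Bohr transform of a bounded holomorphic function -/

section BohrTransform

open Metric

variable {X : Type*} [NormedAddCommGroup X] [NormedSpace ℂ X]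

open Classical in
/-- The extension by zero of a function on the unit ball of `c₀`. -/
noncomputable def ballExt (F : HardyBall X) (z : C₀(ℕ, ℂ)) : X :=
  if h : z ∈ ball 0 1 then (F : UnitBall →ᵇ X) ⟨z, h⟩ else 0

theorem ballExt_of_mem (F : HardyBall X) {z : C₀(ℕ, ℂ)} (h : z ∈ ball 0 1) :
    ballExt F z = (F : UnitBall →ᵇ X) ⟨z, h⟩ := dif_pos h

theorem ballExt_coe (F : HardyBall X) (z : UnitBall) :
    ballExt F z = (F : UnitBall →ᵇ X) z := ballExt_of_mem F z.2

theorem differentiableOn_ballExt (F : HardyBall X) :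
    DifferentiableOn ℂ (ballExt F) (ball 0 1) := by
  obtain ⟨G, hG, h⟩ := F.2
  exact hG.congr fun z hz => by rw [ballExt_of_mem F hz, ← h ⟨z, hz⟩]

theorem norm_ballExt_le (F : HardyBall X) : ∀ z ∈ ball 0 1, ‖ballExt F z‖ ≤ ‖F‖ := fun z hz => by
  rw [ballExt_of_mem F hz]
  exact (F : UnitBall →ᵇ X).norm_coe_le_norm _

theorem continuous_ballExt_rot (F : HardyBall X) {z : C₀(ℕ, ℂ)} (hz : z ∈ ball 0 1) :
    Continuous fun ω => ballExt F (rot ω z) :=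
  continuous_comp_rot (differentiableOn_ballExt F).continuousOn hz

theorem ballExt_add (F G : HardyBall X) (z : C₀(ℕ, ℂ)) :
    ballExt (F + G) z = ballExt F z + ballExt G z := by
  by_cases h : z ∈ ball 0 1
  · simp only [ballExt_of_mem _ h]
    rfl
  · simp only [ballExt, dif_neg h, add_zero]

theorem ballExt_smul (c : ℂ) (F : HardyBall X) (z : C₀(ℕ, ℂ)) :
    ballExt (c • F) z = c • ballExt F z := by
  by_cases h : z ∈ ball 0 1
  · simp only [ballExt_of_mem _ h]
    rfl
  · simp only [ballExt, dif_neg h, smul_zero]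

theorem integrable_monomial_smul_ballExt (F : HardyBall X) (α : ℕ →₀ ℤ) {z : C₀(ℕ, ℂ)}
    (hz : z ∈ ball 0 1) :
    Integrable (fun ω => (torusMonomial α ω : ℂ) • ballExt F (rot ω z)) torusMeasure :=
  (memLp_of_continuous ((continuous_coe_torusMonomial α).smul
    (continuous_ballExt_rot F hz))).integrable le_top

/-- The monomial coefficients of `F`, listed as a Dirichlet series. -/
noncomputable def bohr : HardyBall X →ₗ[ℂ] (ℕ+ → X) where
  toFun F n := monomialCoeff (ballExt F) (primePowEquiv.symm n)
  map_add' F G := by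
    ext n
    simp only [monomialCoeff, ballCoeff, ballExt_add, smul_add, Pi.add_apply]
    rw [integral_add (integrable_monomial_smul_ballExt F _ (primeSeq_mem _ _))
      (integrable_monomial_smul_ballExt G _ (primeSeq_mem _ _)), smul_add]
  map_smul' c F := by
    ext n
    simp only [monomialCoeff, ballCoeff, ballExt_smul, Pi.smul_apply, RingHom.id_apply,
      smul_comm _ c]
    rw [integral_smul, smul_comm]

theorem bohr_apply (F : HardyBall X) (n : ℕ+) :
    bohr F n = monomialCoeff (ballExt F) (primePowEquiv.symm n) := rfl

theorem bohr_primePow (F : HardyBall X) (α : ℕ →₀ ℕ) :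
    bohr F (primePowEquiv α) = monomialCoeff (ballExt F) α := by
  rw [bohr_apply, Equiv.symm_apply_apply]

theorem primePowEquiv_apply (α : ℕ →₀ ℕ) : primePowEquiv α = primePow α := rfl

variable [CompleteSpace X]

theorem isBohrTransform_bohr (F : HardyBall X) : IsBohrTransform F (bohr F) := by
  intro m z hz
  simp only [bohr_primePow]
  rw [← ballExt_coe]
  exact hasSum_monomialCoeff (differentiableOn_ballExt F) (norm_ballExt_le F) z.2 hz

theorem norm_torusBohrEquiv (f : HardyTorus X) : ‖torusBohrEquiv X f‖ = ‖f‖ := by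
  change ‖(torusBohrEquiv X).symm (torusBohrEquiv X f)‖ = ‖f‖
  rw [LinearEquiv.symm_apply_apply]

/-- The function `ω ↦ F(ω z)` as an element of `H_∞(𝕋^ℕ, X)`. -/
noncomputable def ballToTorus (F : HardyBall X) {z : C₀(ℕ, ℂ)} (hz : z ∈ ball 0 1) :
    HardyTorus X :=
  ⟨(memLp_of_continuous (continuous_ballExt_rot F hz)).toLp, fun α hα => by
    rw [torusCoeff_toLp]
    exact ballCoeff_eq_zero (differentiableOn_ballExt F) (norm_ballExt_le F) hz hα⟩

theorem norm_ballToTorus_le (F : HardyBall X) {z : C₀(ℕ, ℂ)} (hz : z ∈ ball 0 1) :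
    ‖ballToTorus F hz‖ ≤ ‖F‖ := by
  change ‖(memLp_of_continuous (continuous_ballExt_rot F hz)).toLp‖ ≤ ‖F‖
  refine (Lp.norm_le_of_ae_bound (norm_nonneg F) ?_).trans_eq ?_
  · filter_upwards [(memLp_of_continuous (continuous_ballExt_rot F hz)).coeFn_toLp] with ω hω
    rw [hω]
    exact norm_ballExt_le F _ (rot_mem_ball hz ω)
  -- The general bound carries a power of the total mass, here 1.
  · simp [measureUnivNNReal]

/-- The coefficient of ω ↦ F(ω𝔭^{-ε}) at α is (𝔭^{-ε})^α c_α = n^{-ε} a_n. -/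
theorem torusBohr_ballToTorus (F : HardyBall X) {ε : ℝ} (hε : 0 < (ε : ℂ).re) :
    torusBohr X (ballToTorus F (primeSeq_mem ε hε)) = translate X ε (bohr F) := by
  ext n
  change torusCoeff _ (memLp_of_continuous (continuous_ballExt_rot F (primeSeq_mem ε hε))).toLp =
    ((n : ℕ) : ℂ) ^ (-(ε : ℂ)) • bohr F n
  rw [torusCoeff_toLp]
  change ballCoeff (ballExt F) _ _ = _
  rw [ballCoeff_eq (differentiableOn_ballExt F) (norm_ballExt_le F) (primeSeq_mem _ _),
    monomial_primeSeq, ← primePowEquiv_apply, Equiv.apply_symm_apply, bohr_apply]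

theorem exists_translate_bohr (F : HardyBall X) (ε : ℝ) (hε : 0 < ε) :
    ∃ h : translate X ε (bohr F) ∈ HardyDirichlet X,
      ‖(⟨translate X ε (bohr F), h⟩ : HardyDirichlet X)‖ ≤ ‖F‖ := by
  have hε' : 0 < (ε : ℂ).re := hε
  have h : translate X ε (bohr F) ∈ HardyDirichlet X := ⟨_, torusBohr_ballToTorus F hε'⟩
  refine ⟨h, ?_⟩
  have e : (⟨translate X ε (bohr F), h⟩ : HardyDirichlet X) =
      torusBohrEquiv X (ballToTorus F (primeSeq_mem ε hε')) :=
    Subtype.ext (torusBohr_ballToTorus F hε').symm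
  rw [e, norm_torusBohrEquiv]
  exact norm_ballToTorus_le F _

/-- The Bohr transform with values in `𝓗_∞⁺(X)`. -/
noncomputable def bohrPlus : HardyBall X →ₗ[ℂ] HardyDirichletPlus X :=
  bohr.codRestrict _ fun F => ⟨‖F‖, exists_translate_bohr F⟩

theorem coe_bohrPlus (F : HardyBall X) : (bohrPlus F : ℕ+ → X) = bohr F := rfl

theorem norm_bohrPlus_le (F : HardyBall X) : ‖bohrPlus F‖ ≤ ‖F‖ := by
  rw [norm_plus_def]
  exact ciSup_le fun ε => (exists_translate_bohr F ε ε.2).2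

end BohrTransform

/-! ### The holomorphic function of a Dirichlet series in `𝓗_∞⁺(X)` -/

section Inverse

open Metric

variable {X : Type*} [NormedAddCommGroup X] [NormedSpace ℂ X] [CompleteSpace X]

theorem exists_hardyTorus (D : HardyDirichletPlus X) {ε : ℝ} (hε : 0 < ε) :
    ∃ f : HardyTorus X, ‖f‖ ≤ ‖D‖ ∧ ∀ α : ℕ →₀ ℕ,
      torusCoeff (toIntIndex α) (f : Lp X ∞ torusMeasure) =
        ((primePow α : ℕ) : ℂ) ^ (-(ε : ℂ)) • (D : ℕ+ → X) (primePowEquiv α) := by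
  set T := translatePlus X ⟨ε, hε⟩ D with hT
  refine ⟨(torusBohrEquiv X).symm T, norm_translatePlus_le ⟨ε, hε⟩ D, fun α => ?_⟩
  have h : torusBohrEquiv X ((torusBohrEquiv X).symm T) = T := LinearEquiv.apply_symm_apply _ _
  have h1 := congrFun (congrArg Subtype.val h) (primePowEquiv α)
  change torusCoeff (toIntIndex (primePowEquiv.symm (primePowEquiv α))) _ =
    ((primePowEquiv α : ℕ) : ℂ) ^ (-(ε : ℂ)) • (D : ℕ+ → X) (primePowEquiv α) at h1
  rw [Equiv.symm_apply_apply] at h1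
  exact h1

omit [NormedSpace ℂ X] [CompleteSpace X] in
theorem ae_norm_le_norm_top (f : Lp X ∞ torusMeasure) : ∀ᵐ ω ∂torusMeasure, ‖f ω‖ ≤ ‖f‖ := by
  filter_upwards [ae_le_eLpNormEssSup (f := f) (μ := torusMeasure)] with ω hω
  rw [← eLpNorm_exponent_top, ← Lp.enorm_def] at hω
  exact enorm_le_iff_norm_le.1 hω

omit [CompleteSpace X] in
theorem norm_torusCoeff_le (f : Lp X ∞ torusMeasure) (α : ℕ →₀ ℤ) :
    ‖torusCoeff α f‖ ≤ ‖f‖ := by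
  have h := norm_integral_le_of_norm_le_const (μ := torusMeasure) (C := ‖f‖)
    (f := fun ω => (torusMonomial (-α) ω : ℂ) • f ω) (by
      filter_upwards [ae_norm_le_norm_top f] with ω hω
      rwa [norm_smul, norm_torusMonomial, one_mul])
  simpa [torusCoeff] using h

theorem norm_coeff_le (D : HardyDirichletPlus X) (n : ℕ+) : ‖(D : ℕ+ → X) n‖ ≤ ‖D‖ := by
  refine norm_le_of_norm_cpow_smul_le n fun ε hε => ?_
  obtain ⟨f, hf, h⟩ := exists_hardyTorus D hε
  have h1 := h (primePowEquiv.symm n)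
  rw [← primePowEquiv_apply, Equiv.apply_symm_apply] at h1
  rw [← h1]
  exact (norm_torusCoeff_le _ _).trans hf

/-- Only finitely many strict inequalities have to survive a small ε. This is why bounds are first
proved at finitely supported points. -/
theorem exists_mul_prime_cpow_lt_one (m : ℕ) {z : ℕ → ℂ} (h1 : ∀ k, ‖z k‖ < 1) :
    ∃ ε : ℝ, 0 < ε ∧ ∀ k ∈ Finset.range m, ‖z k * (prime k : ℂ) ^ (ε : ℂ)‖ < 1 := by
  have h : ∀ᶠ ε : ℝ in 𝓝[>] 0, ∀ k ∈ Finset.range m, ‖z k * (prime k : ℂ) ^ (ε : ℂ)‖ < 1 := by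
    refine (Filter.eventually_all_finset _).2 fun k _ => ?_
    have hp : (prime k : ℂ) ≠ 0 := Nat.cast_ne_zero.2 (prime_prime k).ne_zero
    have hc : Continuous fun ε : ℝ => ‖z k * (prime k : ℂ) ^ (ε : ℂ)‖ :=
      (continuous_const.mul (Complex.continuous_ofReal.const_cpow (Or.inl hp))).norm
    refine ((hc.tendsto 0).mono_left nhdsWithin_le_nhds).eventually (gt_mem_nhds ?_)
    simpa using h1 k
  obtain ⟨ε, hε, h2⟩ := (eventually_mem_nhdsWithin.and h).exists
  exact ⟨ε, hε, h2⟩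

/-- Multiplying z_k by 𝔭_k^ε cancels the factor n^{-ε} in the coefficients of D_ε, so the sum is the
value at u of the torus function that represents D_ε. -/
theorem norm_tsum_plus_le (D : HardyDirichletPlus X) {m : ℕ} {z : ℕ → ℂ}
    (hz : ∀ k, m ≤ k → z k = 0) (h1 : ∀ k, ‖z k‖ < 1) :
    ‖∑' α, monomial α z • (D : ℕ+ → X) (primePowEquiv α)‖ ≤ ‖D‖ := by
  obtain ⟨ε, hε, hu⟩ := exists_mul_prime_cpow_lt_one m h1
  obtain ⟨f, hf, h⟩ := exists_hardyTorus D hε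
  set u : ℕ → ℂ := fun k => z k * (prime k : ℂ) ^ (ε : ℂ) with hudef
  have hu0 : ∀ k, m ≤ k → u k = 0 := fun k hk => by rw [hudef]; simp [hz k hk]
  have hu1 : ∀ k, ‖u k‖ < 1 := fun k => by
    by_cases hk : k < m
    · exact hu k (Finset.mem_range.2 hk)
    · rw [hu0 k (not_lt.1 hk), norm_zero]
      exact one_pos
  refine le_trans (le_of_eq ?_) ((norm_tsum_monomial_smul_le hu0 hu1
    (integrable_linfty (f : Lp X ∞ torusMeasure)) (fun β hβ => f.2 β hβ)
    (ae_norm_le_norm_top (f : Lp X ∞ torusMeasure))).trans hf)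
  congr 1
  refine tsum_congr fun α => ?_
  change _ = monomial α u • torusCoeff (toIntIndex α) (f : Lp X ∞ torusMeasure)
  have hn : ((primePow α : ℕ) : ℂ) ≠ 0 := Nat.cast_ne_zero.2 (primePow α).ne_zero
  have e : monomial α (fun k => (prime k : ℂ) ^ (ε : ℂ)) = ((primePow α : ℕ) : ℂ) ^ (ε : ℂ) :=
    (primePow_cpow α ε).symm
  rw [h, hudef, monomial_mul, e, smul_smul, mul_assoc, ← Complex.cpow_add _ _ hn,
    add_neg_cancel, Complex.cpow_zero, mul_one]

/-- Evaluation at a coordinate of `c₀`. -/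
noncomputable def coordL (k : ℕ) : C₀(ℕ, ℂ) →L[ℂ] ℂ :=
  LinearMap.mkContinuous ⟨⟨fun z => z k, fun _ _ => rfl⟩, fun _ _ => rfl⟩ 1 fun z => by
    rw [one_mul]
    exact norm_apply_le_norm z k

theorem differentiable_monomial_trunc (α : ℕ →₀ ℕ) (m : ℕ) :
    Differentiable ℂ fun z => monomial α (trunc m z) := by
  have h : ∀ k, Differentiable ℂ fun z => trunc m z k := fun k => by
    simp only [trunc_apply]
    by_cases h : k < m
    · simp only [if_pos h]
      exact (coordL k).differentiable
    · simp only [if_neg h]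
      exact differentiable_const 0
  change Differentiable ℂ fun z => ∏ k ∈ α.support, trunc m z k ^ α k
  classical
  induction α.support using Finset.induction_on with
  | empty => simp
  | insert k s hk ih =>
    simp only [Finset.prod_insert hk]
    exact ((h k).fun_pow _).fun_mul ih

/-- The monomial series with bounded coefficients in the first `m` variables is holomorphic. -/
theorem differentiableOn_tsum_trunc {c : (ℕ →₀ ℕ) → X} {C : ℝ} (hc : ∀ α, ‖c α‖ ≤ C) (m : ℕ) :
    DifferentiableOn ℂ (fun z => ∑' α, monomial α (trunc m z) • c α) (ball 0 1) := by
  intro z hz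
  obtain ⟨r, hr, hr1⟩ := exists_between (mem_ball_zero_iff.1 hz)
  have hr0 : 0 ≤ r := (norm_nonneg z).trans hr.le
  -- The point (r, …, r, 0, …) dominates every truncation to m variables from the ball of radius r,
  -- so its monomials majorize the series there.
  set u : ℕ → ℂ := fun k => if k < m then (r : ℂ) else 0 with hu
  have hu0 : ∀ k, m ≤ k → u k = 0 := fun k hk => if_neg (not_lt.2 hk)
  have hu1 : ∀ k, ‖u k‖ < 1 := fun k => by
    simp only [hu]
    split_ifs
    · rwa [Complex.norm_real, Real.norm_of_nonneg hr0]
    · simp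
  have hle : ∀ w ∈ ball (0 : C₀(ℕ, ℂ)) r, ∀ α, ‖monomial α (trunc m w) • c α‖ ≤
      ‖monomial α u‖ * C := fun w hw α => by
    rw [norm_smul]
    refine mul_le_mul (norm_monomial_le_of_le (fun k => ?_) α) (hc α) (norm_nonneg _)
      (norm_nonneg _)
    rw [trunc_apply]
    simp only [hu]
    split_ifs
    · rw [Complex.norm_real, Real.norm_of_nonneg hr0]
      exact (norm_apply_le_norm w k).trans (mem_ball_zero_iff.1 hw).le
    · rfl
  have hs : Summable fun α => ‖monomial α u‖ * C := (summable_norm_monomial hu0 hu1).mul_right C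
  have h := differentiableOn_of_tendsto_of_bounded (l := atTop) (c := (0 : C₀(ℕ, ℂ))) (R := r)
    (C := ∑' α, ‖monomial α u‖ * C)
    (g := fun (S : Finset (ℕ →₀ ℕ)) z => ∑ α ∈ S, monomial α (trunc m z) • c α)
    (f := fun z => ∑' α, monomial α (trunc m z) • c α)
    (fun S => Differentiable.differentiableOn (Differentiable.fun_sum fun α _ =>
      (differentiable_monomial_trunc α m).smul_const _))
    (fun S w hw => (norm_sum_le _ _).trans ((Finset.sum_le_sum fun α _ => hle w hw α).trans
      (hs.sum_le_tsum S fun α _ => (norm_nonneg _).trans (hle w hw α))))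
    (fun w hw => (Summable.of_norm_bounded hs (hle w hw)).hasSum)
  exact (h.differentiableAt (isOpen_ball.mem_nhds
    (mem_ball_zero_iff.2 hr))).differentiableWithinAt

/-- For n ≥ N, G_N(z) is the value of G_n at the N-th truncation of z. The Schwarz lemma on the ball
of radius 1 - ‖z‖ about z bounds its distance from G_n(z) uniformly in n, so the sequence is Cauchy.
-/
theorem exists_tendsto_of_trunc {G : ℕ → C₀(ℕ, ℂ) → X} {C : ℝ}
    (hd : ∀ m, DifferentiableOn ℂ (G m) (ball 0 1)) (hC : ∀ m, ∀ z ∈ ball 0 1, ‖G m z‖ ≤ C)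
    (hG : ∀ m n, m ≤ n → ∀ z, G n (trunc m z) = G m z) {z : C₀(ℕ, ℂ)} (hz : z ∈ ball 0 1) :
    ∃ y, Tendsto (fun m => G m z) atTop (𝓝 y) := by
  refine cauchySeq_tendsto_of_complete (Metric.cauchySeq_iff'.2 fun ε hε => ?_)
  set r : ℝ := 1 - ‖z‖ with hr
  have hr0 : 0 < r := sub_pos.2 (mem_ball_zero_iff.1 hz)
  have hsub : ball z r ⊆ ball 0 1 := ball_subset_ball' (by rw [dist_zero_right]; linarith)
  have h0 : Tendsto (fun m => ‖trunc m z - z‖) atTop (𝓝 0) :=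
    tendsto_iff_norm_sub_tendsto_zero.1 (tendsto_trunc z)
  have h1 : Tendsto (fun m => 2 * C / r * ‖trunc m z - z‖) atTop (𝓝 0) := by
    simpa using h0.const_mul (2 * C / r)
  obtain ⟨N, hN1, hN2⟩ := ((h0.eventually (gt_mem_nhds hr0)).and
    (h1.eventually (gt_mem_nhds hε))).exists
  refine ⟨N, fun n hn => ?_⟩
  rw [dist_comm, dist_eq_norm, ← hG N n hn]
  refine lt_of_le_of_lt (dist_le_of_bounded hr0 ((hd n).mono hsub)
    (fun w hw => hC n w (hsub hw)) ?_) hN2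
  rwa [mem_ball, dist_eq_norm]

theorem exists_isBohrTransform (D : HardyDirichletPlus X) :
    ∃ F : HardyBall X, IsBohrTransform F (D : ℕ+ → X) := by
  set c : (ℕ →₀ ℕ) → X := fun α => (D : ℕ+ → X) (primePowEquiv α) with hc
  set G : ℕ → C₀(ℕ, ℂ) → X := fun m z => ∑' α, monomial α (trunc m z) • c α with hG
  have hd : ∀ m, DifferentiableOn ℂ (G m) (ball 0 1) :=
    differentiableOn_tsum_trunc fun α => norm_coeff_le D (primePowEquiv α)
  have hC : ∀ m, ∀ z ∈ ball 0 1, ‖G m z‖ ≤ ‖D‖ := fun m z hz =>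
    norm_tsum_plus_le D (m := m) (fun k hk => trunc_apply_eq_zero hk z)
      (norm_apply_lt_one (trunc_mem_ball hz m))
  have hcomp : ∀ m n, m ≤ n → ∀ z, G n (trunc m z) = G m z := fun m n h z => by
    simp only [hG, trunc_trunc h]
  choose! f hf using fun z (hz : z ∈ ball (0 : C₀(ℕ, ℂ)) 1) =>
    exists_tendsto_of_trunc hd hC hcomp hz
  have hfd : DifferentiableOn ℂ f (ball 0 1) := differentiableOn_of_tendsto_of_bounded hd hC hf
  have hfC : ∀ z ∈ ball 0 1, ‖f z‖ ≤ ‖D‖ := fun z hz =>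
    le_of_tendsto (hf z hz).norm (Eventually.of_forall fun m => hC m z hz)
  refine ⟨⟨BoundedContinuousFunction.ofNormedAddCommGroup (fun z : UnitBall => f z)
    (hfd.continuousOn.comp_continuous continuous_subtype_val fun z => z.2) ‖D‖
    fun z => hfC z z.2, f, hfd, fun _ => rfl⟩, fun m z hz => ?_⟩
  change HasSum _ (f z)
  have e : f z = G m z := by
    refine tendsto_nhds_unique (hf z z.2) (tendsto_const_nhds.congr' ?_)
    filter_upwards [Filter.eventually_ge_atTop m] with n hn
    rw [← hcomp m n hn, trunc_eq_self hz]
  rw [e]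
  simp only [hG, trunc_eq_self hz]
  exact (summable_norm_monomial_smul (fun α => norm_coeff_le D (primePowEquiv α)) hz
    (norm_apply_lt_one z.2)).of_norm.hasSum

theorem bohr_eq_of_isBohrTransform {F : HardyBall X} {D : HardyDirichletPlus X}
    (h : IsBohrTransform F (D : ℕ+ → X)) : bohrPlus F = D := by
  have h1 := monomialCoeff_eq_of_hasSum (differentiableOn_ballExt F) (norm_ballExt_le F)
    (fun α => norm_coeff_le D (primePowEquiv α)) fun m z hz hm => by
      rw [ballExt_of_mem F hz]
      exact h m ⟨z, hz⟩ hm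
  apply Subtype.ext
  funext n
  rw [coe_bohrPlus, bohr_apply, h1]
  exact congrArg _ (Equiv.apply_symm_apply _ _)

/-- F(z) is the limit of F at the truncations of z, where F is the sum of its monomial series and
`norm_tsum_plus_le` applies. -/
theorem norm_le_norm_bohrPlus (F : HardyBall X) : ‖F‖ ≤ ‖bohrPlus F‖ := by
  refine (BoundedContinuousFunction.norm_le (norm_nonneg _)).2 fun z => ?_
  change ‖(F : UnitBall →ᵇ X) z‖ ≤ _
  rw [← ballExt_coe]
  have h1 : Tendsto (fun m => ballExt F (trunc m z)) atTop (𝓝 (ballExt F z)) :=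
    ((differentiableOn_ballExt F).continuousOn.continuousAt
      (isOpen_ball.mem_nhds z.2)).tendsto.comp (tendsto_trunc z)
  refine le_of_tendsto h1.norm (Eventually.of_forall fun m => ?_)
  have hm := trunc_mem_ball z.2 m
  have h0 : ∀ k, m ≤ k → trunc m z k = 0 := fun k hk => trunc_apply_eq_zero hk _
  rw [ballExt_of_mem F hm, ← (isBohrTransform_bohr F m ⟨_, hm⟩ h0).tsum_eq]
  exact norm_tsum_plus_le (bohrPlus F) h0 (norm_apply_lt_one hm)

/-- The Bohr transform as an isometric isomorphism. -/
noncomputable def bohrIsometryEquiv : HardyBall X ≃ₗᵢ[ℂ] HardyDirichletPlus X :=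
  LinearIsometryEquiv.ofSurjective
    ⟨bohrPlus, fun F => le_antisymm (norm_bohrPlus_le F) (norm_le_norm_bohrPlus F)⟩ fun D => by
      obtain ⟨F, hF⟩ := exists_isBohrTransform D
      exact ⟨F, bohr_eq_of_isBohrTransform hF⟩

end Inverse

/-! ### A kernel of Perron type -/

section Kernel

open Real FourierTransform

/-- The denominator of the Perron kernel. -/
noncomputable def perronPoint (σ ξ : ℝ) : ℂ := σ + 2 * π * ξ * Complex.I

theorem perronPoint_re (σ ξ : ℝ) : (perronPoint σ ξ).re = σ := by
  simp [perronPoint]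

theorem perronPoint_im (σ ξ : ℝ) : (perronPoint σ ξ).im = 2 * π * ξ := by
  simp [perronPoint]

theorem perronPoint_ne_zero {σ : ℝ} (hσ : 0 < σ) (ξ : ℝ) : perronPoint σ ξ ≠ 0 := fun h => by
  have := perronPoint_re σ ξ
  rw [h, Complex.zero_re] at this
  exact hσ.ne this

theorem continuous_perronPoint (σ : ℝ) : Continuous (perronPoint σ) := by
  unfold perronPoint
  fun_prop

theorem le_norm_perronPoint (σ ξ : ℝ) :
    min σ 1 / 2 * (1 + ‖ξ‖) ≤ ‖perronPoint σ ξ‖ := by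
  have h1 : σ ≤ ‖perronPoint σ ξ‖ := by
    have := Complex.re_le_norm (perronPoint σ ξ)
    rwa [perronPoint_re] at this
  have h2 : ‖ξ‖ ≤ ‖perronPoint σ ξ‖ := by
    have := Complex.abs_im_le_norm (perronPoint σ ξ)
    rw [perronPoint_im, abs_mul, abs_of_pos two_pi_pos] at this
    refine le_trans ?_ this
    rw [Real.norm_eq_abs]
    have := two_le_pi
    nlinarith [abs_nonneg ξ]
  have h3 : min σ 1 ≤ σ := min_le_left _ _
  have h4 : min σ 1 ≤ 1 := min_le_right _ _
  nlinarith [norm_nonneg ξ]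

theorem integrable_norm_perronPoint_rpow {σ p : ℝ} (hσ : 0 < σ) (hp : 1 < p) :
    Integrable fun ξ => ‖perronPoint σ ξ‖ ^ (-p) := by
  have hc : 0 < min σ 1 / 2 := by positivity
  have h : Integrable (fun ξ : ℝ => (min σ 1 / 2) ^ (-p) * (1 + ‖ξ‖) ^ (-p)) :=
    (integrable_one_add_norm (by simpa using hp)).const_mul _
  refine h.mono' ?_ (ae_of_all _ fun ξ => ?_)
  · refine Continuous.aestronglyMeasurable ?_
    exact (continuous_perronPoint σ).norm.rpow_const fun ξ =>
      Or.inl (norm_ne_zero_iff.2 (perronPoint_ne_zero hσ ξ))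
  · rw [Real.norm_of_nonneg (by positivity), ← mul_rpow hc.le (by positivity)]
    exact rpow_le_rpow_of_nonpos (by positivity) (le_norm_perronPoint σ ξ) (by linarith)

theorem integrable_inv_sq_perronPoint {σ : ℝ} (hσ : 0 < σ) :
    Integrable fun ξ => 1 / perronPoint σ ξ ^ 2 := by
  refine (integrable_norm_perronPoint_rpow hσ one_lt_two).mono' ?_ (ae_of_all _ fun ξ => ?_)
  · refine Continuous.aestronglyMeasurable ?_
    exact continuous_const.div₀ ((continuous_perronPoint σ).pow 2) fun ξ =>
      pow_ne_zero 2 (perronPoint_ne_zero hσ ξ)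
  · rw [norm_div, norm_one, norm_pow, rpow_neg (norm_nonneg _), one_div, rpow_two]

/-- The function `x₊ e^{-σx}`. -/
noncomputable def rampExp (σ x : ℝ) : ℂ := (max x 0 * rexp (-σ * x) : ℝ)

theorem continuous_rampExp (σ : ℝ) : Continuous (rampExp σ) := by
  unfold rampExp
  fun_prop

theorem rampExp_eq_indicator (σ : ℝ) (g : ℝ → ℂ) :
    (fun x => g x * rampExp σ x) =
      (Set.Ioi 0).indicator fun x => g x * ((x * rexp (-σ * x) : ℝ) : ℂ) := by
  funext x
  by_cases hx : 0 < x
  · rw [Set.indicator_of_mem (Set.mem_Ioi.2 hx), rampExp, max_eq_left hx.le]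
  · rw [Set.indicator_of_notMem (fun h => hx (Set.mem_Ioi.1 h)), rampExp,
      max_eq_right (not_lt.1 hx)]
    simp

theorem integrable_rampExp {σ : ℝ} (hσ : 0 < σ) : Integrable (rampExp σ) := by
  have h := rampExp_eq_indicator σ fun _ => 1
  simp only [one_mul] at h
  change Integrable fun x => rampExp σ x
  rw [h, integrable_indicator_iff measurableSet_Ioi]
  have h1 := integrableOn_rpow_mul_exp_neg_mul_rpow (s := 1) (p := 1) (b := σ) (by norm_num)
    one_pos hσ
  simp only [rpow_one] at h1
  exact h1.ofReal

theorem norm_exp_neg_perronPoint_mul (σ ξ a : ℝ) :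
    ‖Complex.exp (-(perronPoint σ ξ * a))‖ = rexp (-σ * a) := by
  rw [Complex.norm_exp, Complex.neg_re, Complex.re_mul_ofReal, perronPoint_re, neg_mul]

theorem tendsto_ofReal_mul_exp_neg {w : ℂ} (hw : 0 < w.re) :
    Tendsto (fun x : ℝ => x * Complex.exp (-(w * x))) atTop (𝓝 0) := by
  rw [tendsto_zero_iff_norm_tendsto_zero]
  refine (tendsto_rpow_mul_exp_neg_mul_atTop_nhds_zero 1 w.re hw).congr' ?_
  filter_upwards [Filter.eventually_ge_atTop 0] with x hx
  rw [norm_mul, Complex.norm_exp, Complex.neg_re, Complex.re_mul_ofReal, Complex.norm_real,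
    Real.norm_of_nonneg hx, rpow_one, neg_mul]

theorem tendsto_exp_neg_mul_ofReal {w : ℂ} (hw : 0 < w.re) :
    Tendsto (fun x : ℝ => Complex.exp (-(w * x))) atTop (𝓝 0) := by
  rw [tendsto_zero_iff_norm_tendsto_zero]
  refine (tendsto_rpow_mul_exp_neg_mul_atTop_nhds_zero 0 w.re hw).congr fun x => ?_
  rw [Complex.norm_exp, Complex.neg_re, Complex.re_mul_ofReal, rpow_zero, one_mul, neg_mul]

theorem integral_Ioi_mul_exp_neg {w : ℂ} (hw : 0 < w.re)
    (hint : IntegrableOn (fun x : ℝ => x * Complex.exp (-(w * x))) (Set.Ioi 0)) :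
    ∫ x : ℝ in Set.Ioi 0, x * Complex.exp (-(w * x)) = 1 / w ^ 2 := by
  have hw0 : w ≠ 0 := fun h => by simp [h] at hw
  have hderiv : ∀ x ∈ Set.Ici (0 : ℝ), HasDerivAt
      (fun x : ℝ => -(w⁻¹ * (x * Complex.exp (-(w * x)))) - w⁻¹ ^ 2 * Complex.exp (-(w * x)))
      (x * Complex.exp (-(w * x))) x := fun x _ => by
    have h1 : HasDerivAt (fun x : ℝ => (x : ℂ)) 1 x := Complex.ofRealCLM.hasDerivAt
    have h2 : HasDerivAt (fun x : ℝ => Complex.exp (-(w * x)))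
        (Complex.exp (-(w * x)) * (-(w * 1))) x := ((h1.const_mul w).fun_neg).cexp
    have h3 := (((h1.fun_mul h2).const_mul w⁻¹).fun_neg).fun_sub (h2.const_mul (w⁻¹ ^ 2))
    have e : -(w⁻¹ * (1 * Complex.exp (-(w * x)) + x * (Complex.exp (-(w * x)) * -(w * 1)))) -
        w⁻¹ ^ 2 * (Complex.exp (-(w * x)) * -(w * 1)) = x * Complex.exp (-(w * x)) := by
      generalize Complex.exp (-(w * x)) = E
      field_simp
      ring
    rwa [e] at h3
  have hlim : Tendsto (fun x : ℝ =>
      -(w⁻¹ * (x * Complex.exp (-(w * x)))) - w⁻¹ ^ 2 * Complex.exp (-(w * x))) atTop (𝓝 0) := by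
    have := (((tendsto_ofReal_mul_exp_neg hw).const_mul w⁻¹).neg).sub
      ((tendsto_exp_neg_mul_ofReal hw).const_mul (w⁻¹ ^ 2))
    rwa [mul_zero, mul_zero, neg_zero, sub_zero] at this
  rw [integral_Ioi_of_hasDerivAt_of_tendsto' hderiv hint hlim]
  simp

theorem fourier_rampExp {σ : ℝ} (hσ : 0 < σ) (ξ : ℝ) :
    𝓕 (rampExp σ) ξ = 1 / perronPoint σ ξ ^ 2 := by
  rw [Real.fourier_real_eq_integral_exp_smul]
  simp only [smul_eq_mul]
  have hint : Integrable fun x : ℝ =>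
      Complex.exp ((-2 * π * x * ξ : ℝ) * Complex.I) * rampExp σ x := by
    refine (integrable_rampExp hσ).bdd_mul (c := 1)
      (Continuous.aestronglyMeasurable (by fun_prop)) (ae_of_all _ fun x => ?_)
    rw [Complex.norm_exp_ofReal_mul_I]
  have e : (fun x : ℝ => Complex.exp ((-2 * π * x * ξ : ℝ) * Complex.I) *
      ((x * rexp (-σ * x) : ℝ) : ℂ)) = fun x : ℝ => x * Complex.exp (-(perronPoint σ ξ * x)) := by
    funext x
    have h1 : ((x * rexp (-σ * x) : ℝ) : ℂ) = x * Complex.exp (-σ * x) := by push_cast; rfl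
    rw [h1, mul_left_comm, ← Complex.exp_add]
    congr 2
    simp only [perronPoint]
    push_cast
    ring
  rw [rampExp_eq_indicator, integrable_indicator_iff measurableSet_Ioi, e] at hint
  rw [rampExp_eq_indicator, integral_indicator measurableSet_Ioi, e]
  exact integral_Ioi_mul_exp_neg (by rwa [perronPoint_re]) hint

/-- Fourier inversion for the continuous function x₊e^{-σx}. The ramp is used because its transform
decays quadratically and is therefore integrable. -/
theorem integral_inv_sq_perronPoint {σ : ℝ} (hσ : 0 < σ) (x : ℝ) :
    ∫ ξ : ℝ, Complex.exp ((2 * π * ξ * x : ℝ) * Complex.I) * (1 / perronPoint σ ξ ^ 2) =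
      rampExp σ x := by
  have hF : 𝓕 (rampExp σ) = fun ξ => 1 / perronPoint σ ξ ^ 2 := funext (fourier_rampExp hσ)
  have h := congrFun ((continuous_rampExp σ).fourierInv_fourier_eq (integrable_rampExp hσ)
    (by rw [hF]; exact integrable_inv_sq_perronPoint hσ)) x
  rw [hF, Real.fourierInv_eq'] at h
  rw [← h]
  refine integral_congr_ae (ae_of_all _ fun ξ => ?_)
  simp only [smul_eq_mul]
  congr 4
  simp
  ring

/-- The Perron kernel with parameters `L` and `δ`. -/
noncomputable def perronKernel (σ L δ ξ : ℝ) : ℂ :=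
  (Complex.exp (-(perronPoint σ ξ * L)) - Complex.exp (-(perronPoint σ ξ * (L + δ)))) / δ *
    (1 / perronPoint σ ξ ^ 2)

theorem continuous_perronKernel {σ : ℝ} (hσ : 0 < σ) (L δ : ℝ) :
    Continuous (perronKernel σ L δ) := by
  have h := continuous_perronPoint σ
  unfold perronKernel
  refine Continuous.mul (by fun_prop) ?_
  exact continuous_const.div₀ (h.pow 2) fun ξ => pow_ne_zero 2 (perronPoint_ne_zero hσ ξ)

theorem norm_one_sub_exp_neg_le {z : ℂ} (hz : 0 ≤ z.re) {q : ℝ} (hq0 : 0 ≤ q) (hq1 : q ≤ 1) :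
    ‖1 - Complex.exp (-z)‖ ≤ 2 * ‖z‖ ^ q := by
  rcases le_total ‖z‖ 1 with h | h
  · have h1 := Complex.norm_exp_sub_one_le (x := -z) (by rwa [norm_neg])
    rw [norm_neg, norm_sub_rev] at h1
    refine h1.trans (mul_le_mul_of_nonneg_left ?_ zero_le_two)
    rcases (norm_nonneg z).eq_or_lt with h0 | h0
    · rw [← h0]
      positivity
    · simpa using rpow_le_rpow_of_exponent_ge h0 h hq1
  · have h1 : ‖Complex.exp (-z)‖ ≤ 1 := by
      rw [Complex.norm_exp, Complex.neg_re]
      exact exp_le_one_iff.2 (by linarith)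
    have h2 : 1 ≤ ‖z‖ ^ q := one_le_rpow h hq0
    calc ‖1 - Complex.exp (-z)‖ ≤ ‖(1 : ℂ)‖ + ‖Complex.exp (-z)‖ := norm_sub_le _ _
      _ ≤ 2 := by rw [norm_one]; linarith
      _ ≤ 2 * ‖z‖ ^ q := by linarith

/-- Interpolation by κ between |1 - e^{-wδ}| ≤ 2|w|δ (κ = 0) and the trivial bound 2 (κ = 1). Any κ
> 0 gives integrable decay in ξ, at the price δ^{-κ}. -/
theorem norm_perronKernel_le {σ L δ κ : ℝ} (hσ : 0 < σ) (hδ : 0 < δ) (hκ0 : 0 ≤ κ) (hκ1 : κ ≤ 1)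
    (ξ : ℝ) : ‖perronKernel σ L δ ξ‖ ≤
      2 * rexp (-σ * L) * δ ^ (-κ) * ‖perronPoint σ ξ‖ ^ (-(1 + κ)) := by
  set w := perronPoint σ ξ with hw
  have hw0 : 0 < ‖w‖ := norm_pos_iff.2 (perronPoint_ne_zero hσ ξ)
  have e : perronKernel σ L δ ξ =
      Complex.exp (-(w * L)) * (1 - Complex.exp (-(w * δ))) / δ * (1 / w ^ 2) := by
    rw [perronKernel, mul_sub, mul_one, ← Complex.exp_add]
    congr 5
    ring
  have h1 : ‖1 - Complex.exp (-(w * δ))‖ ≤ 2 * (‖w‖ * δ) ^ (1 - κ) := by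
    have := norm_one_sub_exp_neg_le (z := w * δ) (q := 1 - κ)
      (by rw [Complex.re_mul_ofReal, hw, perronPoint_re]; positivity) (by linarith) (by linarith)
    rwa [norm_mul, Complex.norm_real, Real.norm_of_nonneg hδ.le] at this
  rw [e, norm_mul, norm_div, norm_mul, norm_exp_neg_perronPoint_mul, Complex.norm_real,
    Real.norm_of_nonneg hδ.le, norm_div, norm_one, norm_pow]
  calc rexp (-σ * L) * ‖1 - Complex.exp (-(w * δ))‖ / δ * (1 / ‖w‖ ^ 2)
      ≤ rexp (-σ * L) * (2 * (‖w‖ * δ) ^ (1 - κ)) / δ * (1 / ‖w‖ ^ 2) := by gcongr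
    _ = 2 * rexp (-σ * L) * δ ^ (-κ) * ‖w‖ ^ (-(1 + κ)) := by
      rw [mul_rpow hw0.le hδ.le, show -κ = (1 - κ) - 1 by ring, rpow_sub_one hδ.ne',
        show -(1 + κ) = (1 - κ) - 2 by ring, rpow_sub hw0 _ 2, rpow_two]
      ring

theorem integrable_perronKernel {σ L δ : ℝ} (hσ : 0 < σ) (hδ : 0 < δ) :
    Integrable (perronKernel σ L δ) := by
  refine ((integrable_norm_perronPoint_rpow hσ (p := 1 + 1) (by norm_num)).const_mul
    (2 * rexp (-σ * L) * δ ^ (-1 : ℝ))).mono'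
    (continuous_perronKernel hσ L δ).aestronglyMeasurable (ae_of_all _ fun ξ => ?_)
  exact norm_perronKernel_le hσ hδ zero_le_one le_rfl ξ

/-- The kernel is a difference quotient of two ramps starting at L and L + δ. Its transform is
e^{-σx} times a cutoff that is 0 up to L, 1 from L + δ on, and linear between. -/
theorem integral_exp_mul_perronKernel {σ L δ : ℝ} (hσ : 0 < σ) (x : ℝ) :
    ∫ ξ : ℝ, Complex.exp ((2 * π * ξ * x : ℝ) * Complex.I) * perronKernel σ L δ ξ =
      (((max (x - L) 0 - max (x - L - δ) 0) / δ * rexp (-σ * x) : ℝ) : ℂ) := by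
  have hI : ∀ a : ℝ, Integrable fun ξ : ℝ =>
      Complex.exp ((2 * π * ξ * a : ℝ) * Complex.I) * (1 / perronPoint σ ξ ^ 2) := fun a => by
    refine (integrable_inv_sq_perronPoint hσ).bdd_mul (c := 1)
      (Continuous.aestronglyMeasurable (by fun_prop)) (ae_of_all _ fun ξ => ?_)
    rw [Complex.norm_exp_ofReal_mul_I]
  have e : ∀ ξ : ℝ, Complex.exp ((2 * π * ξ * x : ℝ) * Complex.I) * perronKernel σ L δ ξ =
      (rexp (-σ * L) / δ : ℝ) * (Complex.exp ((2 * π * ξ * (x - L) : ℝ) * Complex.I) *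
        (1 / perronPoint σ ξ ^ 2)) -
      (rexp (-σ * (L + δ)) / δ : ℝ) * (Complex.exp ((2 * π * ξ * (x - L - δ) : ℝ) * Complex.I) *
        (1 / perronPoint σ ξ ^ 2)) := fun ξ => by
    have e1 : ∀ a : ℝ, Complex.exp ((2 * π * ξ * x : ℝ) * Complex.I) *
        Complex.exp (-(perronPoint σ ξ * a)) =
        (rexp (-σ * a) : ℝ) * Complex.exp ((2 * π * ξ * (x - a) : ℝ) * Complex.I) := fun a => by
      rw [Complex.ofReal_exp, ← Complex.exp_add, ← Complex.exp_add]
      congr 1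
      simp only [perronPoint]
      push_cast
      ring
    have e2 := e1 L
    have e3 := e1 (L + δ)
    rw [sub_add_eq_sub_sub] at e3
    push_cast at e2 e3 ⊢
    rw [perronKernel]
    linear_combination (1 / δ * (1 / perronPoint σ ξ ^ 2)) * e2 -
      (1 / δ * (1 / perronPoint σ ξ ^ 2)) * e3
  simp only [e]
  rw [integral_sub ((hI _).const_mul _) ((hI _).const_mul _), integral_const_mul,
    integral_const_mul, integral_inv_sq_perronPoint hσ, integral_inv_sq_perronPoint hσ,
    rampExp, rampExp, ← Complex.ofReal_mul, ← Complex.ofReal_mul, ← Complex.ofReal_sub]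
  congr 1
  have e4 : rexp (-σ * x) = rexp (-σ * L) * rexp (-σ * (x - L)) := by
    rw [← Real.exp_add]; congr 1; ring
  have e5 : rexp (-σ * x) = rexp (-σ * (L + δ)) * rexp (-σ * (x - L - δ)) := by
    rw [← Real.exp_add]; congr 1; ring
  linear_combination (-(max (x - L) 0) / δ) * e4 + (max (x - L - δ) 0 / δ) * e5

/-- The Perron kernel separating the integers up to `N` from the larger ones. -/
noncomputable def sumKernel (σ : ℝ) (N : ℕ) (ξ : ℝ) : ℂ :=
  perronKernel σ (log N) (log (N + 1) - log N) ξ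

theorem inv_le_log_succ_sub_log {N : ℕ} (hN : 0 < N) :
    ((N : ℝ) + 1)⁻¹ ≤ log (N + 1) - log N := by
  have hN' : (0 : ℝ) < N := Nat.cast_pos.2 hN
  rw [← log_div (by positivity) hN'.ne']
  refine le_trans (le_of_eq ?_) (one_sub_inv_le_log_of_pos (by positivity))
  field_simp
  ring

theorem integrable_sumKernel {σ : ℝ} (hσ : 0 < σ) {N : ℕ} (hN : 0 < N) :
    Integrable (sumKernel σ N) :=
  integrable_perronKernel hσ (lt_of_lt_of_le (by positivity) (inv_le_log_succ_sub_log hN))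

/-- With L = log N and L + δ = log(N + 1), no log n falls strictly inside the linear part of the
cutoff, so the smooth kernel still separates the integers sharply. -/
theorem integral_exp_mul_sumKernel {σ : ℝ} (hσ : 0 < σ) {N : ℕ} (hN : 0 < N) (n : ℕ)
    (hn : 0 < n) :
    ∫ ξ : ℝ, Complex.exp ((2 * π * ξ * log n : ℝ) * Complex.I) * sumKernel σ N ξ =
      if n ≤ N then 0 else (n : ℂ) ^ (-(σ : ℂ)) := by
  have hδ : 0 < log (N + 1) - log N := lt_of_lt_of_le (by positivity) (inv_le_log_succ_sub_log hN)
  have hn' : (0 : ℝ) < n := Nat.cast_pos.2 hn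
  have h := integral_exp_mul_perronKernel (L := log N) (δ := log (N + 1) - log N) hσ (log n)
  rw [sub_sub, add_sub_cancel] at h
  simp only [sumKernel]
  rw [h]
  split_ifs with hnN
  · have h1 : log n ≤ log N := log_le_log hn' (Nat.cast_le.2 hnN)
    rw [max_eq_right (by linarith), max_eq_right (by linarith)]
    simp
  · have h1 : log (N + 1) ≤ log n := log_le_log (by positivity) (by exact_mod_cast not_le.1 hnN)
    rw [max_eq_left (by linarith), max_eq_left (by linarith), sub_sub_sub_cancel_left,
      div_self hδ.ne', one_mul, ← Complex.ofReal_neg, ← Complex.ofReal_natCast,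
      ← Complex.ofReal_cpow hn'.le, rpow_def_of_pos hn', mul_comm]

/-- The gap δ is at least 1/(N + 1), so the factor δ^{-κ} costs at most a constant times N^κ,
against e^{-σ log N} = N^{-σ}. -/
theorem exists_integral_norm_sumKernel_le {σ : ℝ} (hσ : 0 < σ) :
    ∃ η : ℕ → ℝ, Tendsto η atTop (𝓝 0) ∧
      ∀ N, 0 < N → ∫ ξ, ‖sumKernel σ N ξ‖ ≤ η N := by
  -- This choice gives 0 < κ ≤ 1 for the kernel bound and κ < σ, so that N^{κ-σ} tends to 0.
  set κ : ℝ := min σ 1 / 2 with hκ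
  have hκ0 : 0 < κ := by positivity
  have hκ1 : κ ≤ 1 := by have := min_le_right σ 1; linarith
  have hκσ : 0 < σ - κ := by have := min_le_left σ 1; linarith
  set J : ℝ := ∫ ξ, ‖perronPoint σ ξ‖ ^ (-(1 + κ)) with hJ
  have hJ0 : 0 ≤ J := integral_nonneg fun ξ => by positivity
  refine ⟨fun N => 2 * 2 ^ κ * J * (N : ℝ) ^ (-(σ - κ)), ?_, fun N hN => ?_⟩
  · simpa using ((tendsto_rpow_neg_atTop hκσ).comp tendsto_natCast_atTop_atTop).const_mul
      (2 * 2 ^ κ * J)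
  · have hN' : (1 : ℝ) ≤ N := by exact_mod_cast hN
    have hδ := inv_le_log_succ_sub_log hN
    have hδ0 : 0 < log (N + 1) - log N := lt_of_lt_of_le (by positivity) hδ
    have h1 : (log (N + 1) - log N) ^ (-κ) ≤ 2 ^ κ * (N : ℝ) ^ κ := by
      calc (log (N + 1) - log N) ^ (-κ) ≤ (((N : ℝ) + 1)⁻¹) ^ (-κ) :=
            rpow_le_rpow_of_nonpos (by positivity) hδ (by linarith)
        _ = ((N : ℝ) + 1) ^ κ := by
            rw [inv_rpow (by positivity), rpow_neg (by positivity), inv_inv]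
        _ ≤ (2 * N : ℝ) ^ κ := rpow_le_rpow (by positivity) (by linarith) hκ0.le
        _ = 2 ^ κ * (N : ℝ) ^ κ := mul_rpow zero_le_two (by positivity)
    have h2 : rexp (-σ * log N) = (N : ℝ) ^ (-σ) := by
      rw [rpow_def_of_pos (by positivity), mul_comm]
    calc ∫ ξ, ‖sumKernel σ N ξ‖
        ≤ ∫ ξ, 2 * rexp (-σ * log N) * (log (N + 1) - log N) ^ (-κ) *
            ‖perronPoint σ ξ‖ ^ (-(1 + κ)) := by
          refine integral_mono (integrable_sumKernel hσ hN).norm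
            ((integrable_norm_perronPoint_rpow hσ (by linarith)).const_mul _) fun ξ => ?_
          exact norm_perronKernel_le hσ hδ0 hκ0.le hκ1 ξ
      _ = 2 * rexp (-σ * log N) * (log (N + 1) - log N) ^ (-κ) * J := integral_const_mul _ _
      _ ≤ 2 * rexp (-σ * log N) * (2 ^ κ * (N : ℝ) ^ κ) * J := by gcongr
      _ = 2 * 2 ^ κ * J * (N : ℝ) ^ (-(σ - κ)) := by
          rw [h2, show -(σ - κ) = -σ + κ by ring, rpow_add (by positivity)]
          ring

end Kernel

/-! ### Convergence of the Dirichlet series -/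

section Convergence

open Metric

/-- The point `𝔭^{2πiξ}` of the torus. -/
noncomputable def bohrFlow (ξ : ℝ) (k : ℕ) : Circle :=
  Circle.exp (2 * Real.pi * ξ * Real.log (prime k))

theorem natCast_cpow_mul_I {n : ℕ} (hn : 0 < n) (t : ℝ) :
    (n : ℂ) ^ (t * Complex.I) = Complex.exp ((t * Real.log n : ℝ) * Complex.I) := by
  rw [Complex.cpow_def_of_ne_zero (Nat.cast_ne_zero.2 hn.ne'), ← Complex.natCast_log]
  congr 1
  push_cast
  ring

theorem torusMonomial_bohrFlow (α : ℕ →₀ ℕ) (ξ : ℝ) :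
    (torusMonomial (toIntIndex α) (bohrFlow ξ) : ℂ) =
      Complex.exp ((2 * Real.pi * ξ * Real.log (primePow α : ℕ) : ℝ) * Complex.I) := by
  rw [← monomial_circle, ← natCast_cpow_mul_I (primePow α).pos, primePow_cpow]
  refine Finset.prod_congr rfl fun k _ => ?_
  simp only
  rw [natCast_cpow_mul_I (prime_prime k).pos, bohrFlow, Circle.coe_exp]

theorem tendsto_monomial_trunc (α : ℕ →₀ ℕ) (z : C₀(ℕ, ℂ)) :
    Tendsto (fun m => monomial α (trunc m z)) atTop (𝓝 (monomial α z)) := by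
  refine tendsto_finsetProd _ fun k _ => Tendsto.pow ?_ _
  refine tendsto_const_nhds.congr' ?_
  filter_upwards [Filter.eventually_gt_atTop k] with m hm
  rw [trunc_apply, if_pos hm]

theorem monomial_trunc_primeSeq (α : ℕ →₀ ℕ) (m : ℕ) {s : ℂ} {σ : ℝ} (hs : 0 < s.re)
    (hs' : 0 < (s - σ).re) :
    monomial α (trunc m (primeSeq s hs)) =
      monomial α (trunc m (primeSeq (s - σ) hs')) * ((primePow α : ℕ) : ℂ) ^ (-(σ : ℂ)) := by
  have e : ((primePow α : ℕ) : ℂ) ^ (-(σ : ℂ)) =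
      monomial α fun k => (prime k : ℂ) ^ (-(σ : ℂ)) := primePow_cpow α _
  rw [e, ← monomial_mul]
  congr 1
  funext k
  rw [trunc_apply, trunc_apply]
  split_ifs
  · have hp : (prime k : ℂ) ≠ 0 := Nat.cast_ne_zero.2 (prime_prime k).ne_zero
    change (prime k : ℂ) ^ (-s) = (prime k : ℂ) ^ (-(s - σ)) * (prime k : ℂ) ^ (-(σ : ℂ))
    rw [← Complex.cpow_add _ _ hp]
    congr 1
    ring
  · rw [zero_mul]

variable {X : Type*} [NormedAddCommGroup X] [NormedSpace ℂ X] [CompleteSpace X]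
  {F : C₀(ℕ, ℂ) → X} {C : ℝ}

/-- Along the flow the monomial α is multiplied by n^{2πiξ}, n = 𝔭^α. Since z is finitely supported
the monomial series converges absolutely, so the kernel can be integrated against it term by term,
removing n ≤ N and inserting n^{-σ} for the rest. -/
theorem hasSum_integral_sumKernel (hF : DifferentiableOn ℂ F (ball 0 1))
    (hC : ∀ z ∈ ball 0 1, ‖F z‖ ≤ C) {m : ℕ} {z : C₀(ℕ, ℂ)} (hz : z ∈ ball 0 1)
    (hm : ∀ k, m ≤ k → z k = 0) {σ : ℝ} (hσ : 0 < σ) {N : ℕ} (hN : 0 < N) :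
    HasSum (fun α => (if (primePow α : ℕ) ≤ N then 0 else
        monomial α z * ((primePow α : ℕ) : ℂ) ^ (-(σ : ℂ))) • monomialCoeff F α)
      (∫ ξ : ℝ, sumKernel σ N ξ • F (rot (bohrFlow ξ) z)) := by
  have hK := integrable_sumKernel hσ hN
  have hb := summable_norm_monomial_smul (norm_monomialCoeff_le hF hC) hm (norm_apply_lt_one hz)
  have hint : ∀ α, Integrable fun ξ : ℝ =>
      (Complex.exp ((2 * Real.pi * ξ * Real.log (primePow α : ℕ) : ℝ) * Complex.I) *
        sumKernel σ N ξ) • monomial α z • monomialCoeff F α := fun α => by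
    refine Integrable.smul_const ?_ _
    refine hK.bdd_mul (c := 1) (Continuous.aestronglyMeasurable (by fun_prop))
      (ae_of_all _ fun ξ => ?_)
    rw [Complex.norm_exp_ofReal_mul_I]
  have h := hasSum_integral_of_summable_integral_norm hint (by
    simp only [norm_smul _ (monomial _ z • _), norm_mul, Complex.norm_exp_ofReal_mul_I, one_mul,
      integral_mul_const]
    exact hb.mul_left _)
  have e1 : ∀ ξ : ℝ, ∑' α,
      (Complex.exp ((2 * Real.pi * ξ * Real.log (primePow α : ℕ) : ℝ) * Complex.I) *
        sumKernel σ N ξ) • monomial α z • monomialCoeff F α =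
      sumKernel σ N ξ • F (rot (bohrFlow ξ) z) := fun ξ => by
    rw [← (hasSum_monomialCoeff hF hC (rot_mem_ball hz (bohrFlow ξ)) fun k hk => by
      rw [rot_apply, hm k hk, mul_zero]).tsum_eq, ← tsum_const_smul'']
    refine tsum_congr fun α => ?_
    rw [monomial_rot, torusMonomial_bohrFlow, smul_smul, smul_smul]
    congr 1
    ring
  simp only [e1, integral_smul_const] at h
  refine h.congr_fun fun α => ?_
  rw [integral_exp_mul_sumKernel hσ hN _ (primePow α).pos]
  split_ifs
  · rw [zero_smul, zero_smul]
  · rw [smul_smul, mul_comm]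

/-- At the truncation of 𝔭^{-(s-σ)} the inserted factor n^{-σ} restores the monomials of the
truncation of 𝔭^{-s}, so the integral is the remainder after N terms. The bound is free of m. -/
theorem norm_sub_sum_le (F : HardyBall X) {m N : ℕ} (hN : 0 < N) {s : ℂ} {σ : ℝ} (hσ : 0 < σ)
    (hs : 0 < s.re) (hs' : 0 < (s - σ).re) :
    ‖ballExt F (trunc m (primeSeq s hs)) - ∑ i ∈ Finset.range N,
      monomial (primePowEquiv.symm i.succPNat) (trunc m (primeSeq s hs)) • bohr F i.succPNat‖ ≤
      (∫ ξ, ‖sumKernel σ N ξ‖) * ‖F‖ := by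
  have hF := differentiableOn_ballExt F
  have hC := norm_ballExt_le F
  set z := trunc m (primeSeq (s - σ) hs') with hz
  set v := trunc m (primeSeq s hs) with hv
  have hzb : z ∈ ball 0 1 := trunc_mem_ball (primeSeq_mem _ _) m
  have hvb : v ∈ ball 0 1 := trunc_mem_ball (primeSeq_mem _ _) m
  have h1 := hasSum_integral_sumKernel hF hC hzb (fun k hk => trunc_apply_eq_zero hk _) hσ hN
  have h2 := hasSum_monomialCoeff hF hC hvb (fun k hk => trunc_apply_eq_zero (m := m) hk _)
  set I : X := ∫ ξ : ℝ, sumKernel σ N ξ • ballExt F (rot (bohrFlow ξ) z) with hI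
  have h3 := h2.sub h1
  -- The series is reindexed by i ↦ n = i + 1, so that n ≤ N corresponds to i < N.
  rw [← (Equiv.pnatEquivNat.symm.trans primePowEquiv.symm).hasSum_iff] at h3
  have h4 : HasSum (fun i : ℕ => if i < N then
      monomial (primePowEquiv.symm i.succPNat) v • bohr F i.succPNat else 0)
      (ballExt F v - I) := by
    convert h3 using 2 with i
    have e0 : (Equiv.pnatEquivNat.symm.trans primePowEquiv.symm) i =
        primePowEquiv.symm i.succPNat := rfl
    have e1 : (primePow (primePowEquiv.symm i.succPNat) : ℕ) = i + 1 := by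
      rw [← primePowEquiv_apply, Equiv.apply_symm_apply]
      rfl
    simp only [Function.comp_apply, e0]
    rw [← monomial_trunc_primeSeq _ m hs hs', ← hv, e1, bohr_apply]
    by_cases hi : i < N
    · rw [if_pos hi, if_pos (Nat.succ_le_of_lt hi), zero_smul, sub_zero]
    · rw [if_neg hi, if_neg (by omega), sub_self]
  have h5 : ∑ i ∈ Finset.range N,
      monomial (primePowEquiv.symm i.succPNat) v • bohr F i.succPNat = ballExt F v - I := by
    refine HasSum.unique ?_ h4
    rw [Finset.sum_congr rfl fun i hi => (if_pos (Finset.mem_range.1 hi)).symm]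
    exact hasSum_sum_of_ne_finset_zero fun i hi => if_neg fun h => hi (Finset.mem_range.2 h)
  rw [h5, sub_sub_cancel, hI, ← integral_mul_const]
  refine norm_integral_le_of_norm_le ((integrable_sumKernel hσ hN).norm.mul_const _)
    (ae_of_all _ fun ξ => ?_)
  rw [norm_smul]
  exact mul_le_mul_of_nonneg_left (hC _ (rot_mem_ball hzb _)) (norm_nonneg _)

theorem tendsto_sum_bohr (F : HardyBall X) (s : ℂ) (hs : 0 < s.re) :
    Tendsto (fun N : ℕ => ∑ n ∈ Finset.range N,
        ((n.succPNat : ℕ) : ℂ) ^ (-s) • bohr F n.succPNat)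
      atTop (𝓝 ((F : UnitBall →ᵇ X) (primePoint s hs))) := by
  -- Half of Re s pays for the decay of the kernel; the other half keeps 𝔭^{-(s-σ)} in the ball.
  set σ : ℝ := s.re / 2 with hσdef
  have hσ : 0 < σ := by positivity
  have hs' : 0 < (s - σ).re := by
    rw [Complex.sub_re, Complex.ofReal_re]
    linarith
  obtain ⟨η, hη, hle⟩ := exists_integral_norm_sumKernel_le hσ
  have e : (F : UnitBall →ᵇ X) (primePoint s hs) = ballExt F (primeSeq s hs) :=
    (ballExt_coe F (primePoint s hs)).symm
  rw [e, tendsto_iff_norm_sub_tendsto_zero]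
  have h0 : Tendsto (fun N => η N * ‖F‖) atTop (𝓝 0) := by simpa using hη.mul_const ‖F‖
  refine squeeze_zero' (Eventually.of_forall fun _ => norm_nonneg _) ?_ h0
  filter_upwards [Filter.eventually_gt_atTop 0] with N hN
  rw [norm_sub_rev]
  have h1 : Tendsto (fun m => ballExt F (trunc m (primeSeq s hs))) atTop
      (𝓝 (ballExt F (primeSeq s hs))) :=
    ((differentiableOn_ballExt F).continuousOn.continuousAt
      (isOpen_ball.mem_nhds (primeSeq_mem s hs))).tendsto.comp (tendsto_trunc _)
  have h2 : Tendsto (fun m => ∑ i ∈ Finset.range N,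
      monomial (primePowEquiv.symm i.succPNat) (trunc m (primeSeq s hs)) • bohr F i.succPNat) atTop
      (𝓝 (∑ i ∈ Finset.range N, ((i.succPNat : ℕ) : ℂ) ^ (-s) • bohr F i.succPNat)) := by
    refine tendsto_finsetSum _ fun i _ => Tendsto.smul_const ?_ _
    have h3 := tendsto_monomial_trunc (primePowEquiv.symm i.succPNat) (primeSeq s hs)
    rwa [monomial_primeSeq, ← primePowEquiv_apply, Equiv.apply_symm_apply] at h3
  -- N is fixed while m tends to infinity: the partial sum has finitely many terms, and F is
  -- continuous at 𝔭^{-s}.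
  refine le_of_tendsto (h1.sub h2).norm (Eventually.of_forall fun m => ?_)
  exact (norm_sub_sum_le F hN hσ hs hs').trans
    (mul_le_mul_of_nonneg_right (hle N hN) (norm_nonneg _))

end Convergence

end BohrHardy

theorem mainTheorem6 (X : Type*) [NormedAddCommGroup X] [NormedSpace ℂ X] [CompleteSpace X] :
    ∃ B : HardyBall X ≃ₗᵢ[ℂ] HardyDirichletPlus X,
      (∀ F : HardyBall X, IsBohrTransform F (B F : ℕ+ → X)) ∧
      ∀ (F : HardyBall X) (s : ℂ) (hs : 0 < s.re),
        Tendsto (fun N : ℕ => ∑ n ∈ Finset.range N,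
            ((n.succPNat : ℕ) : ℂ) ^ (-s) • (B F : ℕ+ → X) n.succPNat)
          atTop (𝓝 ((F : UnitBall →ᵇ X) (primePoint s hs))) :=
  ⟨bohrIsometryEquiv, isBohrTransform_bohr, tendsto_sum_bohr⟩
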